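/- Let $M=(m_{ij})$ be an $n\times n$ Coxeter matrix ($m_{ii}=1$, $m_{ij}=m_{ji}\in\{2,3,\dots,\infty\}$ for $i\ne j$), and let $P=A_M^+$ be the associated Artin monoid, i.e. the unital monoid generated by $e_1,\dots,e_n$ with the relations $\langle e_i,e_j\rangle_{m_{ij}}=\langle e_j,e_i\rangle_{m_{ij}}$ for $i\neq j$, $m_{ij}<\infty$, where $\langle s,t\rangle_m=stst\cdots$ ($m$ letters). Assume that $A_M^+$ is of finite type, i.e. that the Coxeter group of $M$ is finite. For $F\subseteq P$ write $\vee F=\{r\in P:\bigcap_{x\in F}xP=rP\}$ and $p\vee q=\vee\{p,q\}$. Let $\mathcal H$ be a complex Hilbert space and $T:P\to\mathcal B(\mathcal H)$ a unital representation (monoid homomorphism) that is contractive ($\|T(p)\|\le 1$ for all $p$). The following are equivalent: 1. $T$ is $*$-regular: the kernel $K(p,q)=T(a)T(b)^*$, where $s=pa=qb\in p\vee q$ (and $K(p,q)=0$ if $p\vee q=\emptyset$), is completely positive definite, i.e. for all $p_1,\dots,p_k\in P$ the operator matrix $[K(p_i,p_j)]_{i,j}$ is positive. 2. $T$ has a minimal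 isometric Nica-covariant dilation: there are a Hilbert space $\mathcal K\supseteq\mathcal H$ and a unital representation $V:P\to\mathcal B(\mathcal K)$ by isometries such that $T(p)=P_{\mathcal H}V(p)|_{\mathcal H}$ for all $p$, $\mathcal K=\overline{\mathrm{span}}\{V(p)h:p\in P,\,h\in\mathcal H\}$, and, for all $p,q\in P$, $V(p)V(p)^*V(q)V(q)^*=V(r)V(r)^*$ if $r\in p\vee q$, and $=0$ if $p\vee q=\emptyset$. 3. For every finite set $F$ of generators, $Z(F)=\sum_{U\subseteq F}(-1)^{|U|}\,TT^*(\vee U)\ge 0$, where $TT^*(\vee U)=T(r)T(r)^*$ for any $r\in\vee U$, and $TT^*(\vee U)=0$ if $\vee U=\emptyset$. For example, let $B_3^+=\langle e_1,e_2: e_1e_2e_1=e_2e_1e_2\rangle$, let $T:B_3^+\to\mathcal B(\mathcal H)$ be a unital representation and $T_i=T(e_i)$. Then $T$ is contractive and $*$-regular if and only if $\|T_1\|\le1$, $\|T_2\|\le 1$ and $$I-T_1T_1^*-T_2T_2^*+T_1T_2T_1T_1^*T_2^*T_1^*\ge 0.$$ -/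

import Mathlib

open scoped ComplexOrder

noncomputable section

/-! ### Artin monoids -/

/-- The alternating word `⟨s, t⟩_m = s t s t ⋯` with `m` letters, starting with `s`. -/
def alternatingFreeWord {B : Type*} (s t : B) : ℕ → FreeMonoid B
  | 0 => 1
  | m + 1 => FreeMonoid.of s * alternatingFreeWord t s m

/-- The defining relations `⟨e_i, e_j⟩_{m_ij} = ⟨e_j, e_i⟩_{m_ij}` for `i ≠ j` with `m_ij < ∞`.
Following Mathlib, the entry `0` of a Coxeter matrix encodes `m_ij = ∞`. -/
inductive ArtinRel {B : Type*} (M : CoxeterMatrix B) : FreeMonoid B → FreeMonoid B → Prop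
  | braid (i j : B) (hij : i ≠ j) (hM : M i j ≠ 0) :
      ArtinRel M (alternatingFreeWord i j (M i j)) (alternatingFreeWord j i (M i j))

/-- The Artin monoid `A_M⁺`. -/
abbrev ArtinMonoid {B : Type*} (M : CoxeterMatrix B) : Type _ := PresentedMonoid (ArtinRel M)

/-- The standard generator `e_i` of the Artin monoid. -/
def artinGen {B : Type*} (M : CoxeterMatrix B) (i : B) : ArtinMonoid M :=
  PresentedMonoid.of (ArtinRel M) i

/-- The Artin monoid of `M` is of finite type if the Coxeter group of `M` is finite. -/
def IsFiniteType {B : Type*} (M : CoxeterMatrix B) : Prop := Finite M.Group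

/-! ### Least common right multiples -/

/-- The principal right ideal `pP`. -/
def principalRightIdeal {P : Type*} [Monoid P] (p : P) : Set P := Set.range fun a : P => p * a

/-- `∨F = {r : ⋂_{x ∈ F} xP = rP}`; the empty intersection is `P`. -/
def joinSet {P : Type*} [Monoid P] (F : Set P) : Set P :=
  {r | ⋂ x ∈ F, principalRightIdeal x = principalRightIdeal r}

section Representations

variable {P : Type*} [Monoid P]
variable {H : Type*} [NormedAddCommGroup H] [InnerProductSpace ℂ H]

/-- A (unital) representation of `P` on `H`, that is a monoid homomorphism into the bounded
operators, is contractive if all its values are contractions. -/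
def IsContractiveRep (T : P →* (H →L[ℂ] H)) : Prop := ∀ p, ‖T p‖ ≤ 1

/-- All operator matrices `[K(p_i, p_j)]` are positive operators on `H ⊕ ⋯ ⊕ H`. -/
def IsCompletelyPositiveDefinite (K : P → P → (H →L[ℂ] H)) : Prop :=
  ∀ (n : ℕ) (p : Fin n → P) (h : Fin n → H),
    0 ≤ ∑ i, ∑ j, inner ℂ (h i) (K (p i) (p j) (h j))

variable [CompleteSpace H]

/-- `K` is the kernel `K(p, q) = T(p⁻¹s) T(q⁻¹s)^*` for all `s ∈ p ∨ q`, and `K(p, q) = 0` if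
`p ∨ q = ∅`. Here `p⁻¹s` is the element `a` with `p a = s`. -/
def IsRegularKernel (T : P →* (H →L[ℂ] H)) (K : P → P → (H →L[ℂ] H)) : Prop :=
  (∀ p q s a b : P, s ∈ joinSet {p, q} → p * a = s → q * b = s →
    K p q = T a * ContinuousLinearMap.adjoint (T b)) ∧
  ∀ p q : P, joinSet {p, q} = ∅ → K p q = 0

/-- There is at most one regular kernel of `T`. -/
theorem IsRegularKernel.unique {T : P →* (H →L[ℂ] H)} {K K' : P → P → (H →L[ℂ] H)}
    (hK : IsRegularKernel T K) (hK' : IsRegularKernel T K') : K = K' := by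
  funext p q
  rcases (joinSet {p, q}).eq_empty_or_nonempty with h | ⟨s, hs⟩
  · rw [hK.2 p q h, hK'.2 p q h]
  · have hmem : s ∈ principalRightIdeal s := ⟨1, mul_one s⟩
    rw [← (show _ = _ from hs)] at hmem
    simp only [Set.mem_insert_iff, Set.mem_singleton_iff, Set.iInter_iInter_eq_or_left,
      Set.iInter_iInter_eq_left, Set.mem_inter_iff] at hmem
    obtain ⟨⟨a, ha⟩, ⟨b, hb⟩⟩ := hmem
    rw [hK.1 p q s a b hs ha hb, hK'.1 p q s a b hs ha hb]

/-- `T` is `∗`-regular (has a `∗`-regular dilation): its regular kernel is completely positive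
definite. -/
def IsStarRegular (T : P →* (H →L[ℂ] H)) : Prop :=
  ∃ K : P → P → (H →L[ℂ] H), IsRegularKernel T K ∧ IsCompletelyPositiveDefinite K

/-- `V` is an isometric Nica-covariant representation. -/
def IsIsometricNicaCovariant (V : P →* (H →L[ℂ] H)) : Prop :=
  (∀ p, Isometry (V p)) ∧
  (∀ p q r : P, r ∈ joinSet {p, q} →
    V p * ContinuousLinearMap.adjoint (V p) * (V q * ContinuousLinearMap.adjoint (V q)) =
      V r * ContinuousLinearMap.adjoint (V r)) ∧
  ∀ p q : P, joinSet {p, q} = ∅ →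
    V p * ContinuousLinearMap.adjoint (V p) * (V q * ContinuousLinearMap.adjoint (V q)) = 0

open Classical in
/-- `TT^*(∨U) = T(p) T(p)^*` for some `p ∈ ∨U`, and `0` if `∨U = ∅`. -/
def joinProj (T : P →* (H →L[ℂ] H)) (U : Set P) : H →L[ℂ] H :=
  if h : (joinSet U).Nonempty then T h.some * ContinuousLinearMap.adjoint (T h.some) else 0

/-- `Z(F) = ∑_{U ⊆ F} (-1)^{|U|} TT^*(∨U)`. -/
def brehmerZ (T : P →* (H →L[ℂ] H)) (F : Finset P) : H →L[ℂ] H :=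
  ∑ U ∈ F.powerset, (-1 : ℂ) ^ U.card • joinProj T (U : Set P)

/-- `V` is a minimal dilation of `T`, where `H` is embedded isometrically in `K` by `J`:
`T(p) = P_H V(p)|_H` for all `p`, and the vectors `V(p) h` span a dense subspace of `K`. -/
def IsMinimalDilation {K : Type*} [NormedAddCommGroup K] [InnerProductSpace ℂ K] [CompleteSpace K]
    (T : P →* (H →L[ℂ] H)) (J : H →ₗᵢ[ℂ] K) (V : P →* (K →L[ℂ] K)) : Prop :=
  (∀ p, T p = ContinuousLinearMap.adjoint J.toContinuousLinearMap ∘L V p ∘L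
    J.toContinuousLinearMap) ∧
  (Submodule.span ℂ {x : K | ∃ (p : P) (h : H), V p (J h) = x}).topologicalClosure = ⊤

end Representations

/-- `T` has a minimal isometric Nica-covariant dilation, on some Hilbert space containing `H`. -/
def HasMinimalIsometricNicaDilation.{u, v} {P : Type u} [Monoid P] {H : Type v}
    [NormedAddCommGroup H] [InnerProductSpace ℂ H] [CompleteSpace H]
    (T : P →* (H →L[ℂ] H)) : Prop :=
  ∃ (K : Type (max u v)) (_ : NormedAddCommGroup K) (_ : InnerProductSpace ℂ K)
    (_ : CompleteSpace K) (J : H →ₗᵢ[ℂ] K) (V : P →* (K →L[ℂ] K)),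
    IsMinimalDilation T J V ∧ IsIsometricNicaCovariant V

end

/-! The operator theory needs only a left cancellative monoid with an additive length and least
common right multiples (`GradedLcmMonoid`). Write Z(L, r) for the Brehmer operator of the residuals
r⁻¹(r ∨ x), x ∈ L.

Brehmer positivity gives a positive kernel by a Cholesky factorization. Close {p_i} under joins and
order the closure by length; then [K(p_i, p_j)] is the sum over q in the closure of R_q^* Z(later
elements, q) R_q, where R_q has entries T(p_i⁻¹q)^* for p_i ∣ q and 0 otherwise
(`sum_inner_one_sub_brehmerList_nonneg`). This uses Z ≥ 0 for all finite lists. Lists of generators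
suffice because Z(pq, L) = Z(p, L) + T(p) Z(q, p⁻¹(p ∨ L)) T(p)^* (`brehmerList_mul_cons`).

A positive kernel is invariant under left translation, so translation acts by isometries on its
Kolmogorov space, and the explicit adjoint gives Nica covariance. Conversely, for a Nica-covariant V
the range projections commute, Z is the product of the 1 - V(x)V(x)^*, and minimality makes H
co-invariant; hence the kernel of T is a Gram matrix and Z of T is a compression of a projection.

The algebraic half shows that a finite-type Artin monoid is of this kind. The geometric
representation shows that s_i s_j has order exactly m_ij. The reflection cocycle modulo 2 gives
strong exchange, so an element with two left descents begins with the longest dihedral element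
(`exists_altWord_prefix`). From this follow Matsumoto's theorem, meets in the weak order and the
longest element. The monoid then acts on pairs (w, p), thought of as products w·p, by greedy
absorption; the action yields cancellation and the lcm of two generators, and an induction extends
lcms to all pairs. -/

noncomputable section

/-! ### The geometric representation and the order of a product of two simple reflections -/

namespace CoxeterMatrix

open Module Polynomial.Chebyshev

variable {B : Type*} (M : CoxeterMatrix B)

/-- The functional `2 ⟨α_i, ·⟩` of the geometric representation. -/
def corootForm (i : B) : Dual ℝ (B →₀ ℝ) :=
  Finsupp.linearCombination ℝ fun j => -2 * Real.cos (Real.pi / M i j)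

theorem corootForm_single (i j : B) :
    M.corootForm i (Finsupp.single j 1) = -2 * Real.cos (Real.pi / M i j) := by
  simp [corootForm]

theorem corootForm_self (i : B) : M.corootForm i (Finsupp.single i 1) = 2 := by
  simp [corootForm_single]

/-- The geometric representation on simple reflections. -/
def geomReflection (i : B) : (B →₀ ℝ) ≃ₗ[ℝ] (B →₀ ℝ) := reflection (M.corootForm_self i)

theorem sin_two_pi_div_ne_zero {m : ℕ} (hm : 3 ≤ m) : Real.sin (2 * (Real.pi / m)) ≠ 0 := by
  have h3 : (3 : ℝ) ≤ m := by exact_mod_cast hm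
  have hpos : 0 < Real.pi / m := by positivity
  refine (Real.sin_pos_of_pos_of_lt_pi (by positivity) ?_).ne'
  rw [← mul_div_assoc, div_lt_iff₀ (by linarith)]
  nlinarith [Real.pi_pos]

theorem corootForm_mul_sub_two (i j : B) :
    M.corootForm i (Finsupp.single j 1) * M.corootForm j (Finsupp.single i 1) - 2 =
      2 * Real.cos (2 * (Real.pi / M i j)) := by
  rw [corootForm_single, corootForm_single, M.symmetric j i, Real.cos_two_mul]
  ring

theorem eval_S_mul_sin (n : ℤ) (θ : ℝ) {m : ℕ} (hm : 3 ≤ m) (hθ : θ = 2 * (Real.pi / m))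
    {r : ℝ} (h : Real.sin ((n + 1) * θ) = r * Real.sin θ) :
    (S ℝ n).eval (2 * Real.cos θ) = r := by
  have hs : Real.sin θ ≠ 0 := hθ ▸ sin_two_pi_div_ne_zero hm
  apply mul_right_cancel₀ hs
  rw [S_two_mul_real_cos, h]

/-- Powers of a product of two reflections are given by Chebyshev values S_n(2 cos θ) =
sin((n+1)θ)/sin θ with θ = 2π/m, and at exponent m a factor of each coefficient vanishes. The cases
m = 2, where sin θ = 0, and m = ∞ are separate. -/
theorem isLiftable_geomReflection : M.IsLiftable M.geomReflection := by
  intro i j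
  rcases eq_or_ne i j with rfl | hij
  · rw [M.diagonal, pow_one]
    ext1 x
    exact involutive_reflection (M.corootForm_self i) x
  have h1 := M.off_diagonal i j hij
  rcases Nat.lt_or_ge (M i j) 3 with h3 | h3
  · have : M i j = 0 ∨ M i j = 2 := by omega
    rcases this with h | h
    · rw [h, pow_zero]
    · have hi : M.corootForm i (Finsupp.single j 1) = 0 := by simp [corootForm_single, h]
      have hj : M.corootForm j (Finsupp.single i 1) = 0 := by
        simp [corootForm_single, M.symmetric j i, h]
      rw [h, pow_two]
      ext1 x
      have hr (k : B) (y : B →₀ ℝ) :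
          M.geomReflection k y = y - M.corootForm k y • Finsupp.single k 1 := rfl
      change _ = x
      simp only [LinearEquiv.mul_apply, hr, map_sub, map_smul, hi, hj, corootForm_self,
        smul_eq_mul, mul_zero, sub_zero]
      module
  · apply LinearEquiv.toLinearMap_injective
    have key := reflection_mul_reflection_pow (M.corootForm_self i) (M.corootForm_self j) (M i j)
      _ (M.corootForm_mul_sub_two i j).symm
    rw [geomReflection, geomReflection, key]
    set θ := 2 * (Real.pi / M i j) with hθ
    have hm0 : (M i j : ℝ) ≠ 0 := by positivity
    rcases Nat.even_or_odd' (M i j) with ⟨p, hp | hp⟩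
    · have e1 : ((M i j : ℤ) - 2) / 2 = p - 1 := by omega
      have e2 : ((M i j : ℤ) - 1) / 2 = p - 1 := by omega
      have h0 : (S ℝ ((p : ℤ) - 1)).eval (2 * Real.cos θ) = 0 := by
        apply eval_S_mul_sin _ _ h3 hθ
        have : (((p : ℤ) - 1 : ℤ) + 1 : ℝ) * θ = Real.pi := by
          have : (M i j : ℝ) = 2 * p := by exact_mod_cast hp
          rw [hθ]; push_cast; field_simp; rw [this]; ring
        rw [this]; simp
      rw [e1, e2, h0]
      simp
    · have e1 : ((M i j : ℤ) - 2) / 2 = p - 1 := by omega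
      have e2 : ((M i j : ℤ) - 1) / 2 = p := by omega
      have e3 : ((M i j : ℤ) - 3) / 2 = p - 1 := by omega
      have e4 : ((M i j : ℤ)) / 2 = p := by omega
      have hmp : (M i j : ℝ) = 2 * p + 1 := by exact_mod_cast hp
      have hs : Real.sin θ ≠ 0 := hθ ▸ sin_two_pi_div_ne_zero h3
      have h0 : (S ℝ (p : ℤ)).eval (2 * Real.cos θ) +
          (S ℝ ((p : ℤ) - 1)).eval (2 * Real.cos θ) = 0 := by
        apply mul_right_cancel₀ hs
        rw [add_mul, S_two_mul_real_cos, S_two_mul_real_cos]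
        have a1 : (((p : ℤ) : ℝ) + 1) * θ = Real.pi / M i j + Real.pi := by
          rw [hθ]; push_cast; field_simp; rw [hmp]; ring
        have a2 : (((p : ℤ) - 1 : ℤ) + 1 : ℝ) * θ = Real.pi - Real.pi / M i j := by
          rw [hθ]; push_cast; field_simp; rw [hmp]; ring
        rw [a1, a2, Real.sin_add_pi, Real.sin_pi_sub]; ring
      rw [e1, e2, e3, e4, h0]
      simp

/-- Evaluate the power at α_i and compare coordinates: for m ≥ 3 this gives sin kθ = 0 and cos kθ =
1, hence kθ ∈ 2πℤ. -/
theorem dvd_of_geomReflection_mul_pow_eq_one {i j : B} (hij : i ≠ j) {k : ℕ}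
    (h : (M.geomReflection i * M.geomReflection j) ^ k = 1) : M i j ∣ k := by
  have key := reflection_mul_reflection_pow_apply_self (M.corootForm_self i) (M.corootForm_self j) k
    _ (M.corootForm_mul_sub_two i j).symm
  change ((M.geomReflection i * M.geomReflection j) ^ k) _ = _ at key
  rw [h] at key
  have hi := DFunLike.congr_fun key i
  have hj := DFunLike.congr_fun key j
  simp [hij, hij.symm, corootForm_single, M.symmetric j i] at hi hj
  have h1 := M.off_diagonal i j hij
  rcases Nat.lt_or_ge (M i j) 3 with h3 | h3
  · have : M i j = 0 ∨ M i j = 2 := by omega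
    rcases this with h | h
    -- For m = ∞, encoded by 0, the convention π/0 = 0 gives θ = 0; the α_i-coordinate grows
    -- linearly in k, so k = 0.
    · rw [h] at hi
      simp [S_eval_two] at hi
      have hk : (k : ℝ) = 0 := by linarith
      rw [h]; simpa using hk
    · rw [h] at hi
      have e : 2 * (Real.pi / (2 : ℕ)) = Real.pi := by push_cast; ring
      rw [e, Real.cos_pi] at hi
      norm_num [S_eval_neg_two, Int.negOnePow_sub] at hi
      rw [h]
      by_contra hk
      have : Odd k := Nat.not_even_iff_odd.mp fun h => hk h.two_dvd
      rw [this.neg_one_pow] at hi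
      norm_num at hi
  · have hm3 : (3 : ℝ) ≤ M i j := by exact_mod_cast h3
    have hm0 : (M i j : ℝ) ≠ 0 := by positivity
    have hcos : Real.cos (Real.pi / M i j) ≠ 0 := by
      refine (Real.cos_pos_of_mem_Ioo ⟨?_, ?_⟩).ne'
      · have : 0 < Real.pi / M i j := by positivity
        linarith [Real.pi_pos]
      · rw [div_lt_div_iff_of_pos_left Real.pi_pos (by linarith) (by norm_num)]
        linarith
    have hs := sin_two_pi_div_ne_zero h3
    set θ := 2 * (Real.pi / M i j) with hθ
    have hS : (S ℝ ((k : ℤ) - 1)).eval (2 * Real.cos θ) = 0 := by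
      rcases hj with hj | hj
      · exact hj
      · exact absurd hj hcos
    rw [hS, add_zero] at hi
    have a1 := S_two_mul_real_cos θ (k : ℤ)
    have a2 := S_two_mul_real_cos θ ((k : ℤ) - 1)
    rw [← hi, one_mul] at a1
    rw [hS, zero_mul] at a2
    push_cast at a1 a2
    have a3 : Real.sin (k * θ) = 0 := by rw [a2]; congr 1; ring
    rw [show ((k : ℝ) + 1) * θ = k * θ + θ by ring, Real.sin_add, a3, zero_mul, zero_add] at a1
    have a4 : Real.cos (k * θ) = 1 := by
      apply mul_right_cancel₀ hs; rw [← a1, one_mul]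
    obtain ⟨n, hn⟩ := (Real.cos_eq_one_iff _).mp a4
    have : (n : ℝ) * M i j = k := by
      rw [hθ] at hn
      have hpi := Real.pi_ne_zero
      field_simp at hn
      linarith
    have h5 : n * (M i j : ℤ) = k := by exact_mod_cast this
    exact Int.natCast_dvd_natCast.mp ⟨n, by rw [← h5, mul_comm]⟩

end CoxeterMatrix

namespace CoxeterSystem

variable {B W : Type*} [Group W] {M : CoxeterMatrix B} (cs : CoxeterSystem M W)

theorem dvd_of_simple_mul_simple_pow_eq_one {i j : B} (hij : i ≠ j) {k : ℕ}
    (h : (cs.simple i * cs.simple j) ^ k = 1) : M i j ∣ k := by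
  apply M.dvd_of_geomReflection_mul_pow_eq_one hij
  have := congrArg (cs.lift ⟨_, M.isLiftable_geomReflection⟩) h
  simpa using this

end CoxeterSystem

end

/-! ### The reflection cocycle modulo 2 and strong exchange -/

noncomputable section

/-- The alternating list `[i, j, i, …]` with `k` entries. -/
def altWord {B : Type*} (i j : B) : ℕ → List B
  | 0 => []
  | k + 1 => i :: altWord j i k

theorem length_altWord {B : Type*} (i j : B) (k : ℕ) : (altWord i j k).length = k := by
  induction k generalizing i j with
  | zero => rfl
  | succ k ih => simp [altWord, ih]

theorem lift_alternatingFreeWord {B P : Type*} [Monoid P] (f : B → P) (i j : B) (k : ℕ) :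
    FreeMonoid.lift f (alternatingFreeWord i j k) = ((altWord i j k).map f).prod := by
  induction k generalizing i j with
  | zero => simp [alternatingFreeWord, altWord]
  | succ k ih => simp [alternatingFreeWord, altWord, ih]

namespace CoxeterSystem

variable {B W : Type*} [Group W] {M : CoxeterMatrix B} (cs : CoxeterSystem M W)

open Classical in
/-- The affine map `(f, w) ↦ (δ_{s_i} + s_i • f, s_i w)` by which `s_i` acts on
`(W → ℤ/2) × W`. -/
def affineReflection (i : B) : Function.End ((W → ZMod 2) × W) := fun x =>
  (fun t => (if t = cs.simple i then 1 else 0) + x.1 (cs.simple i * t * cs.simple i),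
    cs.simple i * x.2)

open Classical in
theorem affineReflection_mul_pow (i j : B) (n : ℕ) (x : (W → ZMod 2) × W) :
    ((cs.affineReflection i * cs.affineReflection j) ^ n) x =
      (fun t => ∑ k ∈ Finset.range (2 * n),
          (if t = (cs.simple i * cs.simple j) ^ k * cs.simple i then 1 else 0) +
          x.1 (((cs.simple i * cs.simple j) ^ n)⁻¹ * t * (cs.simple i * cs.simple j) ^ n),
        (cs.simple i * cs.simple j) ^ n * x.2) := by
  induction n with
  | zero => simp [Function.End.one_def]
  | succ n ih =>
    rw [pow_succ']
    change cs.affineReflection i (cs.affineReflection j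
      (((cs.affineReflection i * cs.affineReflection j) ^ n) x)) = _
    rw [ih]
    set c := cs.simple i * cs.simple j with hc
    refine Prod.ext ?_ ?_
    · funext t
      change (if t = cs.simple i then (1 : ZMod 2) else 0) +
        ((if cs.simple i * t * cs.simple i = cs.simple j then (1 : ZMod 2) else 0) +
        (∑ k ∈ Finset.range (2 * n), (if cs.simple j * (cs.simple i * t * cs.simple i) *
            cs.simple j = c ^ k * cs.simple i then (1 : ZMod 2) else 0) +
          x.1 ((c ^ n)⁻¹ * (cs.simple j * (cs.simple i * t * cs.simple i) * cs.simple j) * c ^ n)))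
        = _
      have hci : c⁻¹ = cs.simple j * cs.simple i := by simp [hc]
      have h1 : cs.simple j * (cs.simple i * t * cs.simple i) * cs.simple j = c⁻¹ * t * c := by
        rw [hci, hc]; group
      have hsc : cs.simple i * c⁻¹ = c * cs.simple i := by rw [hci, hc]; group
      have h2 (k : ℕ) : (c⁻¹ * t * c = c ^ k * cs.simple i) ↔
          t = c ^ (k + 1 + 1) * cs.simple i := by
        have : c ^ (k + 1 + 1) * cs.simple i = c * (c ^ k * cs.simple i) * c⁻¹ := by
          rw [mul_assoc c, mul_assoc (c ^ k), hsc, ← mul_assoc, ← mul_assoc, ← pow_succ',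
            ← pow_succ]
        rw [this]
        constructor
        · intro h; rw [← h]; group
        · intro h; rw [h]; group
      have h3 : (cs.simple i * t * cs.simple i = cs.simple j) ↔ t = c ^ (0 + 1) * cs.simple i := by
        rw [zero_add, pow_one, hc]
        constructor
        · intro h; rw [← h]; simp [mul_assoc]
        · intro h; rw [h]; simp [mul_assoc]
      rw [h1]
      simp only [h2, h3]
      rw [show 2 * (n + 1) = 2 * n + 1 + 1 by ring, Finset.sum_range_succ', Finset.sum_range_succ',
        pow_zero, one_mul, show (c ^ n)⁻¹ * (c⁻¹ * t * c) * c ^ n = (c ^ (n + 1))⁻¹ * t * c ^ (n + 1)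
          by rw [pow_succ']; group]
      ring
    · change cs.simple i * (cs.simple j * (c ^ n * x.2)) = _
      rw [pow_succ', hc]
      simp only [mul_assoc]

/-- The power m counts the reflections c^k s_i for k < 2m, where c = s_i s_j. Since c^m = 1, the
second half repeats the first and the count cancels modulo 2. -/
theorem isLiftable_affineReflection : M.IsLiftable cs.affineReflection := by
  classical
  intro i j
  funext x
  rw [affineReflection_mul_pow]
  refine Prod.ext (funext fun t => ?_) ?_
  · simp only [two_mul, Finset.sum_range_add, pow_add, cs.simple_mul_simple_pow, one_mul]
    rw [CharTwo.add_self_eq_zero]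
    simp [Function.End.one_def]
  · simp [Function.End.one_def]

/-- The parity of the number of times that `t` occurs in the inversion sequence of a word
of `w`. -/
def invParity (w : W) : W → ZMod 2 :=
  (cs.lift ⟨_, cs.isLiftable_affineReflection⟩ w (0, 1)).1

theorem lift_affineReflection_apply (w : W) (x : (W → ZMod 2) × W) :
    cs.lift ⟨_, cs.isLiftable_affineReflection⟩ w x =
      (fun t => cs.invParity w t + x.1 (w⁻¹ * t * w), w * x.2) := by
  have key : ∀ w : W, ∀ x : (W → ZMod 2) × W,
      cs.lift ⟨_, cs.isLiftable_affineReflection⟩ w x =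
      (fun t => (cs.lift ⟨_, cs.isLiftable_affineReflection⟩ w (0, 1)).1 t + x.1 (w⁻¹ * t * w),
        w * x.2) := by
    intro w
    induction w using cs.simple_induction_left with
    | one =>
      intro x
      simp [Function.End.one_def]
    | mul_simple_left w i ih =>
      intro x
      rw [map_mul, lift_apply_simple]
      change cs.affineReflection i (cs.lift ⟨_, cs.isLiftable_affineReflection⟩ w x) =
        (fun t => (cs.affineReflection i
          (cs.lift ⟨_, cs.isLiftable_affineReflection⟩ w (0, 1))).1 t + _, _)
      rw [ih x]
      simp only [affineReflection, mul_inv_rev, inv_simple, mul_assoc, add_assoc]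
  exact key w x

@[simp]
theorem invParity_one (t : W) : cs.invParity 1 t = 0 := by
  simp [invParity, Function.End.one_def]

theorem invParity_mul (a b t : W) :
    cs.invParity (a * b) t = cs.invParity a t + cs.invParity b (a⁻¹ * t * a) := by
  have h : cs.lift ⟨_, cs.isLiftable_affineReflection⟩ (a * b) (0, 1) =
      cs.lift ⟨_, cs.isLiftable_affineReflection⟩ a
        (cs.lift ⟨_, cs.isLiftable_affineReflection⟩ b (0, 1)) := by rw [map_mul]; rfl
  rw [cs.lift_affineReflection_apply a] at h
  exact congrFun (congrArg Prod.fst h) t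

open Classical in
theorem invParity_simple (i : B) (t : W) :
    cs.invParity (cs.simple i) t = if t = cs.simple i then 1 else 0 := by
  simp [invParity, affineReflection]

/-- For t = u s u⁻¹ the contributions of u and u⁻¹ add up to the parity of u u⁻¹ = 1, which is 0;
only the middle letter counts. -/
theorem invParity_self {t : W} (ht : cs.IsReflection t) : cs.invParity t t = 1 := by
  obtain ⟨u, i, rfl⟩ := ht
  have h0 := cs.invParity_mul u u⁻¹ (u * cs.simple i * u⁻¹)
  rw [mul_inv_cancel, invParity_one] at h0
  rw [mul_assoc u (cs.simple i), invParity_mul, invParity_mul, ← mul_assoc u (cs.simple i)]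
  have e1 : u⁻¹ * (u * cs.simple i * u⁻¹) * u = cs.simple i := by group
  rw [e1] at h0 ⊢
  rw [invParity_simple, if_pos rfl, mul_assoc (cs.simple i)⁻¹, inv_mul_cancel_left]
  linear_combination -h0

theorem mem_leftInvSeq_of_invParity_ne_zero (ω : List B) {t : W}
    (h : cs.invParity (cs.wordProd ω) t ≠ 0) : t ∈ cs.leftInvSeq ω := by
  induction ω generalizing t with
  | nil => simp at h
  | cons i ω ih =>
    rw [wordProd_cons, invParity_mul, invParity_simple] at h
    rw [leftInvSeq, List.mem_cons]
    by_cases ht : t = cs.simple i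
    · exact Or.inl ht
    · rw [if_neg ht, zero_add] at h
      refine Or.inr (List.mem_map.mpr ⟨_, ih h, ?_⟩)
      simp [mul_assoc]

theorem length_mul_lt_of_invParity_ne_zero {w t : W} (h : cs.invParity w t ≠ 0) :
    cs.length (t * w) < cs.length w := by
  obtain ⟨ω, hω, rfl⟩ := cs.exists_isReduced w
  exact (cs.isLeftInversion_of_mem_leftInvSeq hω (cs.mem_leftInvSeq_of_invParity_ne_zero ω h)).2

/-- If t has parity 0 in w, the cocycle rule gives it parity 1 in tw, so t·tw = w is shorter than
tw. -/
theorem invParity_ne_zero_iff {w t : W} (ht : cs.IsReflection t) :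
    cs.invParity w t ≠ 0 ↔ cs.length (t * w) < cs.length w := by
  refine ⟨cs.length_mul_lt_of_invParity_ne_zero, fun h h0 => ?_⟩
  have h1 : cs.invParity (t * w) t ≠ 0 := by
    rw [invParity_mul, cs.invParity_self ht, inv_mul_cancel, one_mul, h0, add_zero]
    exact one_ne_zero
  have := cs.length_mul_lt_of_invParity_ne_zero h1
  rw [← mul_assoc, ht.mul_self, one_mul] at this
  omega

/-! ### Dihedral prefixes -/

theorem altWord_eq_reverse (i j : B) (k : ℕ) :
    altWord i j k = (alternatingWord j i k).reverse := by
  induction k generalizing i j with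
  | zero => rfl
  | succ k ih => rw [altWord, ih, alternatingWord_succ, List.concat_eq_append,
      List.reverse_append, List.reverse_singleton, List.singleton_append]

theorem wordProd_altWord_comm (i j : B) :
    cs.wordProd (altWord i j (M i j)) = cs.wordProd (altWord j i (M i j)) := by
  have h := cs.wordProd_braidWord_eq j i
  rw [braidWord, braidWord, M.symmetric j i] at h
  rw [altWord_eq_reverse, altWord_eq_reverse, wordProd_reverse, wordProd_reverse, h]

theorem exists_of_invParity_altWord_ne_zero (i j : B) (k : ℕ) {t : W}
    (h : cs.invParity (cs.wordProd (altWord i j k)) t ≠ 0) :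
    ∃ r < k, t = (cs.simple i * cs.simple j) ^ r * cs.simple i := by
  induction k generalizing i j t with
  | zero => simp [altWord] at h
  | succ k ih =>
    rw [altWord, wordProd_cons, invParity_mul, invParity_simple] at h
    by_cases ht : t = cs.simple i
    · exact ⟨0, by omega, by simpa using ht⟩
    · rw [if_neg ht, zero_add] at h
      obtain ⟨r, hr, e⟩ := ih j i h
      refine ⟨r + 1, by omega, ?_⟩
      rw [inv_simple] at e
      have : t = cs.simple i * (cs.simple i * t * cs.simple i) * cs.simple i := by simp [mul_assoc]
      rw [this, e]
      have hconj : cs.simple i * (cs.simple j * cs.simple i) ^ r =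
          (cs.simple i * cs.simple j) ^ r * cs.simple i := by
        clear * -
        induction r with
        | zero => simp
        | succ r ih => rw [pow_succ, ← mul_assoc, ih, pow_succ]; simp only [mul_assoc]
      rw [← mul_assoc, hconj, pow_succ]
      simp only [mul_assoc]

/-- With a the alternating prefix, s_j is not an inversion of a. The cocycle thus makes a⁻¹ s_j a an
inversion of y; removing it from y pays for the letter s_j put in front of a. -/
theorem exists_altWord_succ_prefix {i j : B} (hij : i ≠ j) {x y : W} {k : ℕ}
    (hk : M i j = 0 ∨ k < M i j)
    (hx : x = cs.wordProd (altWord i j k) * y) (hl : cs.length x = k + cs.length y)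
    (hj : cs.IsLeftDescent x j) :
    ∃ y', x = cs.wordProd (altWord j i (k + 1)) * y' ∧ cs.length x = k + 1 + cs.length y' := by
  have hN := (cs.invParity_ne_zero_iff (cs.isReflection_simple j)).mpr hj
  set a := cs.wordProd (altWord i j k) with ha
  -- An inversion of a has the form (s_i s_j)^r s_i with r < k; if it were s_j, then (s_i s_j)^(r+1)
  -- = 1 with r + 1 ≤ k < m.
  have hna : cs.invParity a (cs.simple j) = 0 := by
    by_contra h
    obtain ⟨r, hr, e⟩ := cs.exists_of_invParity_altWord_ne_zero i j k h
    have h1 : (cs.simple i * cs.simple j) ^ (r + 1) = 1 := by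
      rw [pow_succ, ← mul_assoc, ← e, cs.simple_mul_simple_self]
    have hd := cs.dvd_of_simple_mul_simple_pow_eq_one hij h1
    rcases hk with h0 | h0
    · rw [h0] at hd
      have := Nat.eq_zero_of_zero_dvd hd
      omega
    · have := Nat.le_of_dvd (by omega) hd
      omega
  rw [hx, invParity_mul, hna, zero_add] at hN
  have hlt := cs.length_mul_lt_of_invParity_ne_zero hN
  refine ⟨a⁻¹ * cs.simple j * a * y, ?_, ?_⟩
  · rw [altWord, wordProd_cons, ← ha, hx]
    simp [mul_assoc]
  · have h1 : x = cs.wordProd (altWord j i (k + 1)) * (a⁻¹ * cs.simple j * a * y) := by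
      rw [altWord, wordProd_cons, ← ha, hx]
      simp [mul_assoc]
    have h2 := cs.length_mul_le (cs.wordProd (altWord j i (k + 1))) (a⁻¹ * cs.simple j * a * y)
    have h3 := cs.length_wordProd_le (altWord j i (k + 1))
    rw [length_altWord] at h3
    rw [← h1] at h2
    omega

/-- An element with two left descents `i ≠ j` starts with the longest element of the dihedral
group of `i` and `j`. -/
theorem exists_altWord_prefix {i j : B} (hij : i ≠ j) {x : W}
    (hi : cs.IsLeftDescent x i) (hj : cs.IsLeftDescent x j) :
    M i j ≠ 0 ∧ ∃ y, x = cs.wordProd (altWord i j (M i j)) * y ∧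
      x = cs.wordProd (altWord j i (M i j)) * y ∧ cs.length x = M i j + cs.length y := by
  have key : ∀ k, (M i j = 0 ∨ k ≤ M i j) →
      (∃ y, x = cs.wordProd (altWord i j k) * y ∧ cs.length x = k + cs.length y) ∧
      (∃ y, x = cs.wordProd (altWord j i k) * y ∧ cs.length x = k + cs.length y) := by
    intro k
    induction k with
    | zero => intro _; exact ⟨⟨x, by simp [altWord]⟩, ⟨x, by simp [altWord]⟩⟩
    | succ k ih =>
      intro hk
      have hk' : M i j = 0 ∨ k < M i j := by omega
      obtain ⟨⟨y, h1, h2⟩, ⟨z, h3, h4⟩⟩ := ih (by omega)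
      exact ⟨cs.exists_altWord_succ_prefix hij.symm (M.symmetric j i ▸ hk') h3 h4 hi,
        cs.exists_altWord_succ_prefix hij hk' h1 h2 hj⟩
  have hM : M i j ≠ 0 := by
    intro h0
    obtain ⟨⟨y, _, h⟩, _⟩ := key (cs.length x + 1) (Or.inl h0)
    omega
  obtain ⟨⟨y, h1, h2⟩, ⟨z, h3, h4⟩⟩ := key (M i j) (Or.inr le_rfl)
  refine ⟨hM, y, h1, ?_, h2⟩
  rw [← cs.wordProd_altWord_comm, ← h1]

end CoxeterSystem

end

noncomputable section

namespace CoxeterSystem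

variable {B W : Type*} [Group W] {M : CoxeterMatrix B} (cs : CoxeterSystem M W)

/-! ### Lifting elements along reduced words -/

theorem isReduced_cons_iff (i : B) (ω : List B) :
    cs.IsReduced (i :: ω) ↔ cs.IsReduced ω ∧ cs.IsLeftDescent (cs.wordProd (i :: ω)) i := by
  have h1 := cs.length_wordProd_le ω
  have h2 := cs.length_simple_mul (cs.wordProd ω) i
  rw [IsLeftDescent, IsReduced, IsReduced, wordProd_cons, simple_mul_simple_cancel_left,
    List.length_cons]
  omega

/-- Matsumoto's theorem: words in a monoid that satisfies the braid relations have the same value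
along all reduced words of the same element. -/
theorem prod_map_eq_of_isReduced {P : Type*} [Monoid P] {e : B → P}
    (he : ∀ i j, i ≠ j → M i j ≠ 0 →
      ((altWord i j (M i j)).map e).prod = ((altWord j i (M i j)).map e).prod)
    {ω ω' : List B} (hω : cs.IsReduced ω) (hω' : cs.IsReduced ω')
    (h : cs.wordProd ω = cs.wordProd ω') : (ω.map e).prod = (ω'.map e).prod := by
  induction hn : ω.length generalizing ω ω' with
  | zero =>
    have h' : ω'.length = 0 := by rw [← hω'.eq, ← h, hω.eq, hn]
    rw [List.length_eq_zero_iff.mp hn, List.length_eq_zero_iff.mp h']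
  | succ n ih =>
    have h' : ω'.length = n + 1 := by rw [← hω'.eq, ← h, hω.eq, hn]
    obtain ⟨i, u, rfl⟩ := List.exists_cons_of_length_eq_add_one hn
    obtain ⟨j, v, rfl⟩ := List.exists_cons_of_length_eq_add_one h'
    obtain ⟨hu, hi⟩ := (cs.isReduced_cons_iff i u).mp hω
    obtain ⟨hv, hj⟩ := (cs.isReduced_cons_iff j v).mp hω'
    rw [← h] at hj
    have hul : u.length = n := by simpa using hn
    have hvl : v.length = n := by simpa using h'
    rcases eq_or_ne i j with rfl | hij
    · rw [List.map_cons, List.map_cons, List.prod_cons, List.prod_cons, ih hu hv _ hul]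
      simpa [wordProd_cons] using h
    obtain ⟨hM, y, h1, h2, h3⟩ := cs.exists_altWord_prefix hij hi hj
    obtain ⟨υ, hυ, rfl⟩ := cs.exists_isReduced y
    have hlen := hω.eq
    rw [hn, h3, hυ.eq] at hlen
    obtain ⟨m, hm⟩ := Nat.exists_eq_succ_of_ne_zero hM
    -- The word k :: u may be replaced by one starting with the full dihedral word: both start with
    -- k, and the induction hypothesis compares their tails.
    have step : ∀ (k l : B) (u : List B), cs.IsReduced u → u.length = n →
        cs.wordProd (k :: u) = cs.wordProd (altWord k l (M i j)) * cs.wordProd υ →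
        ((k :: u).map e).prod = ((altWord k l (M i j)).map e).prod * (υ.map e).prod := by
      intro k l u hu hul hk
      have e1 : cs.wordProd u = cs.wordProd (altWord l k m ++ υ) := by
        rw [hm, altWord, wordProd_cons, wordProd_cons, mul_assoc] at hk
        rw [wordProd_append]
        exact mul_left_cancel hk
      have e2 : cs.IsReduced (altWord l k m ++ υ) := by
        rw [IsReduced, ← e1, hu.eq, hul, List.length_append, length_altWord]
        omega
      rw [hm, altWord, List.map_cons, List.map_cons, List.prod_cons, List.prod_cons,
        ih hu e2 e1 hul, List.map_append, List.prod_append, mul_assoc]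
    rw [step i j u hu hul h1, step j i v hv hvl (h ▸ h2), he i j hij hM]

/-- The map `W → P` induced by elements of `P` with the braid relations, along reduced words. -/
def reducedLift {P : Type*} [Monoid P] (e : B → P) (w : W) : P :=
  ((cs.exists_isReduced w).choose.map e).prod

section reducedLift

variable {P : Type*} [Monoid P] {e : B → P}

theorem reducedLift_wordProd
    (he : ∀ i j, i ≠ j → M i j ≠ 0 →
      ((altWord i j (M i j)).map e).prod = ((altWord j i (M i j)).map e).prod)
    {ω : List B} (hω : cs.IsReduced ω) :
    cs.reducedLift e (cs.wordProd ω) = (ω.map e).prod := by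
  have h := (cs.exists_isReduced (cs.wordProd ω)).choose_spec
  exact cs.prod_map_eq_of_isReduced he h.1 hω h.2.symm

theorem reducedLift_one
    (he : ∀ i j, i ≠ j → M i j ≠ 0 →
      ((altWord i j (M i j)).map e).prod = ((altWord j i (M i j)).map e).prod) :
    cs.reducedLift e 1 = 1 := by
  simpa using cs.reducedLift_wordProd he (ω := []) (by simp [IsReduced])

theorem reducedLift_simple
    (he : ∀ i j, i ≠ j → M i j ≠ 0 →
      ((altWord i j (M i j)).map e).prod = ((altWord j i (M i j)).map e).prod)
    (i : B) : cs.reducedLift e (cs.simple i) = e i := by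
  simpa using cs.reducedLift_wordProd he (ω := [i]) (by simp [IsReduced])

theorem reducedLift_mul
    (he : ∀ i j, i ≠ j → M i j ≠ 0 →
      ((altWord i j (M i j)).map e).prod = ((altWord j i (M i j)).map e).prod)
    {a b : W} (h : cs.length (a * b) = cs.length a + cs.length b) :
    cs.reducedLift e (a * b) = cs.reducedLift e a * cs.reducedLift e b := by
  obtain ⟨ω, hω, rfl⟩ := cs.exists_isReduced a
  obtain ⟨υ, hυ, rfl⟩ := cs.exists_isReduced b
  have hr : cs.IsReduced (ω ++ υ) := by
    rw [IsReduced, wordProd_append, h, hω.eq, hυ.eq, List.length_append]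
  rw [← wordProd_append, cs.reducedLift_wordProd he hr, cs.reducedLift_wordProd he hω,
    cs.reducedLift_wordProd he hυ, List.map_append, List.prod_append]

end reducedLift

/-! ### The weak order -/

/-- `a` is a prefix of `b`: the (right) weak order. -/
def IsPrefix (a b : W) : Prop := cs.length b = cs.length a + cs.length (a⁻¹ * b)

theorem isPrefix_mul_iff {a b : W} :
    cs.IsPrefix a (a * b) ↔ cs.length (a * b) = cs.length a + cs.length b := by
  rw [IsPrefix, inv_mul_cancel_left]

theorem one_isPrefix (a : W) : cs.IsPrefix 1 a := by simp [IsPrefix]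

theorem isPrefix_refl (a : W) : cs.IsPrefix a a := by simp [IsPrefix]

theorem IsPrefix.length_le {cs : CoxeterSystem M W} {a b : W} (h : cs.IsPrefix a b) :
    cs.length a ≤ cs.length b := by
  rw [IsPrefix] at h; omega

theorem length_inv_mul_triangle (a b c : W) :
    cs.length (a⁻¹ * c) ≤ cs.length (a⁻¹ * b) + cs.length (b⁻¹ * c) := by
  have := cs.length_mul_le (a⁻¹ * b) (b⁻¹ * c)
  rwa [mul_assoc, mul_inv_cancel_left] at this

theorem length_le_add_length_inv_mul (a b : W) :
    cs.length b ≤ cs.length a + cs.length (a⁻¹ * b) := by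
  simpa using cs.length_inv_mul_triangle 1 a b

theorem IsPrefix.trans {cs : CoxeterSystem M W} {a b c : W} (h : cs.IsPrefix a b)
    (h' : cs.IsPrefix b c) : cs.IsPrefix a c := by
  have := cs.length_inv_mul_triangle a b c
  have := cs.length_le_add_length_inv_mul a c
  rw [IsPrefix] at *
  omega

/-- Prefixes of `a⁻¹ c` correspond to prefixes of `c` that start with `a`. -/
theorem isPrefix_inv_mul_iff {a b c : W} (h : cs.IsPrefix a c) :
    cs.IsPrefix b (a⁻¹ * c) ↔
      cs.length (a * b) = cs.length a + cs.length b ∧ cs.IsPrefix (a * b) c := by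
  have h1 := cs.length_mul_le a b
  have h2 := cs.length_le_add_length_inv_mul b (a⁻¹ * c)
  have h3 := cs.length_le_add_length_inv_mul (a * b) c
  rw [mul_inv_rev, mul_assoc] at h3
  rw [IsPrefix] at *
  rw [IsPrefix, mul_inv_rev, mul_assoc]
  omega

theorem mul_simple_isPrefix {z x : W} {i : B} (hz : cs.IsPrefix z x) :
    cs.IsPrefix (z * cs.simple i) x ∧ cs.length (z * cs.simple i) = cs.length z + 1 ↔
      cs.IsLeftDescent (z⁻¹ * x) i := by
  have h := cs.isPrefix_inv_mul_iff hz (b := cs.simple i)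
  rw [cs.length_simple] at h
  rw [and_comm, ← h, IsPrefix, IsLeftDescent, inv_simple, cs.length_simple]
  have := cs.length_simple_mul (z⁻¹ * x) i
  omega

/-- A nonempty set of elements of bounded length that is closed under prefixes and under joins of
two covers of an element has a greatest element. -/
theorem exists_greatest_prefix (E : W → Prop) (h1 : E 1) {n : ℕ} (hn : ∀ z, E z → cs.length z ≤ n)
    (hdown : ∀ z y, E y → cs.IsPrefix z y → E z)
    (hjoin : ∀ z i j, i ≠ j → E (z * cs.simple i) → E (z * cs.simple j) →
      cs.length (z * cs.simple i) = cs.length z + 1 →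
      cs.length (z * cs.simple j) = cs.length z + 1 →
      ∃ u, E u ∧ cs.IsPrefix (z * cs.simple i) u ∧ cs.IsPrefix (z * cs.simple j) u) :
    ∃ g, E g ∧ ∀ z, E z → cs.IsPrefix z g := by
  -- Diamond argument, by descending induction on the length of z: a greatest element above z.
  have key : ∀ k z, n - cs.length z = k → E z →
      ∃ g, E g ∧ cs.IsPrefix z g ∧ ∀ y, E y → cs.IsPrefix z y → cs.IsPrefix y g := by
    intro k
    induction k using Nat.strong_induction_on with
    | _ k ih =>
      intro z hk hz
      have cover : ∀ y, cs.IsPrefix z y → y ≠ z → ∃ i, cs.IsPrefix (z * cs.simple i) y ∧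
          cs.length (z * cs.simple i) = cs.length z + 1 := by
        intro y hy hne
        obtain ⟨i, hi⟩ := cs.exists_leftDescent_of_ne_one (w := z⁻¹ * y)
          (fun h => hne (inv_mul_eq_one.mp h).symm)
        exact ⟨i, (cs.mul_simple_isPrefix hy).mpr hi⟩
      by_cases hex : ∃ i, E (z * cs.simple i) ∧ cs.length (z * cs.simple i) = cs.length z + 1
      · obtain ⟨i, hEi, hli⟩ := hex
        have hzi : ∀ i, cs.length (z * cs.simple i) = cs.length z + 1 →
            cs.IsPrefix z (z * cs.simple i) := fun i hi => by
          rw [isPrefix_mul_iff, hi, cs.length_simple]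
        have hi' := hn _ hEi
        obtain ⟨g, hg, hig, hgmax⟩ := ih _ (by omega) (z * cs.simple i) rfl hEi
        refine ⟨g, hg, (hzi i hli).trans hig, fun y hy hzy => ?_⟩
        by_cases hyz : y = z
        · rw [hyz]; exact (hzi i hli).trans hig
        obtain ⟨j, hjy, hlj⟩ := cover y hzy hyz
        have hEj := hdown _ _ hy hjy
        rcases eq_or_ne i j with rfl | hij
        · exact hgmax y hy hjy
        obtain ⟨g', hg', hjg', hg'max⟩ := ih _ (by have := hn _ hEj; omega) (z * cs.simple j) rfl hEj
        obtain ⟨u, hu, hiu, hju⟩ := hjoin z i j hij hEi hEj hli hlj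
        have hlu := hiu.length_le
        obtain ⟨f, hf, huf, hfmax⟩ := ih _ (by have := hn _ hu; omega) u rfl hu
        exact ((hg'max y hy hjy).trans (hfmax g' hg' (hg'max u hu hju))).trans
          (hgmax f hf (hiu.trans huf))
      · refine ⟨z, hz, cs.isPrefix_refl z, fun y hy hzy => ?_⟩
        by_cases hyz : y = z
        · rw [hyz]; exact cs.isPrefix_refl z
        obtain ⟨i, hiy, hli⟩ := cover y hzy hyz
        exact absurd ⟨i, hdown _ _ hy hiy, hli⟩ hex
  obtain ⟨g, hg, -, hmax⟩ := key _ 1 rfl h1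
  exact ⟨g, hg, fun z hz => hmax z hz (cs.one_isPrefix z)⟩

/-- Both s_i and s_j are left descents of z⁻¹x, so z⁻¹x begins with the dihedral longest element. It
supplies the common bound of two covers in the construction of meets. -/
theorem mul_altWord_isPrefix {z x : W} {i j : B} (hij : i ≠ j)
    (hi : cs.IsPrefix (z * cs.simple i) x) (hj : cs.IsPrefix (z * cs.simple j) x)
    (hli : cs.length (z * cs.simple i) = cs.length z + 1)
    (hlj : cs.length (z * cs.simple j) = cs.length z + 1) :
    cs.IsPrefix (z * cs.wordProd (altWord i j (M i j))) x ∧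
      cs.length (z * cs.wordProd (altWord i j (M i j))) = cs.length z + M i j ∧ M i j ≠ 0 := by
  have hz : cs.IsPrefix z x := by
    refine IsPrefix.trans ?_ hi
    rw [isPrefix_mul_iff, hli, cs.length_simple]
  obtain ⟨hM, y, h1, -, h3⟩ := cs.exists_altWord_prefix hij
    ((cs.mul_simple_isPrefix hz).mp ⟨hi, hli⟩) ((cs.mul_simple_isPrefix hz).mp ⟨hj, hlj⟩)
  set a := cs.wordProd (altWord i j (M i j)) with ha
  have hal : cs.length a ≤ M i j := (cs.length_wordProd_le _).trans (length_altWord _ _ _).le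
  have hay := cs.length_mul_le a y
  rw [← h1] at hay
  have hp : cs.IsPrefix a (z⁻¹ * x) := by
    rw [h1, isPrefix_mul_iff, ← h1]
    omega
  obtain ⟨h4, h5⟩ := (cs.isPrefix_inv_mul_iff hz).mp hp
  exact ⟨h5, by omega, hM⟩

/-- Meets exist in the weak order. -/
theorem exists_meet (a b : W) : ∃ c, cs.IsPrefix c a ∧ cs.IsPrefix c b ∧
    ∀ z, cs.IsPrefix z a → cs.IsPrefix z b → cs.IsPrefix z c := by
  obtain ⟨g, hg, hmax⟩ := cs.exists_greatest_prefix (fun z => cs.IsPrefix z a ∧ cs.IsPrefix z b)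
    ⟨cs.one_isPrefix a, cs.one_isPrefix b⟩ (fun z hz => hz.1.length_le)
    (fun z y hy hzy => ⟨hzy.trans hy.1, hzy.trans hy.2⟩) (by
      rintro z i j hij ⟨hia, hib⟩ ⟨hja, hjb⟩ hli hlj
      obtain ⟨ha, hl, hM⟩ := cs.mul_altWord_isPrefix hij hia hja hli hlj
      obtain ⟨hb, -, -⟩ := cs.mul_altWord_isPrefix hij hib hjb hli hlj
      obtain ⟨m, hm⟩ := Nat.exists_eq_succ_of_ne_zero hM
      have hpre : ∀ k l : B, cs.length (z * cs.wordProd (altWord k l (M i j))) =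
          cs.length z + M i j → cs.length (z * cs.simple k) = cs.length z + 1 →
          cs.IsPrefix (z * cs.simple k) (z * cs.wordProd (altWord k l (M i j))) := by
        intro k l h hlk
        have h3 : (z * cs.simple k)⁻¹ * (z * cs.wordProd (altWord k l (M i j))) =
            cs.wordProd (altWord l k m) := by
          rw [hm, altWord, wordProd_cons]
          group
        have h4 := cs.length_wordProd_le (altWord l k m)
        have h5 := cs.length_le_add_length_inv_mul (z * cs.simple k)
          (z * cs.wordProd (altWord k l (M i j)))
        rw [length_altWord] at h4
        rw [IsPrefix]
        rw [h3] at h5 ⊢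
        omega
      refine ⟨_, ⟨ha, hb⟩, hpre i j hl hli, ?_⟩
      rw [cs.wordProd_altWord_comm] at hl ⊢
      exact hpre j i hl hlj)
  exact ⟨g, hg.1, hg.2, fun z h h' => hmax z ⟨h, h'⟩⟩

/-- A finite Coxeter group has a longest element, the greatest element of the weak order. -/
theorem exists_longest [Finite W] : ∃ w₀ : W, ∀ w, cs.IsPrefix w w₀ := by
  obtain ⟨w₀, hmax⟩ := Finite.exists_max cs.length
  -- An element of maximal length has every reflection as an inversion.
  have hrefl : ∀ t, cs.IsReflection t → cs.invParity w₀ t ≠ 0 := fun t ht => by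
    rw [cs.invParity_ne_zero_iff ht]
    exact lt_of_le_of_ne (hmax _) (ht.length_mul_right_ne w₀)
  refine ⟨w₀, fun w => ?_⟩
  induction hn : cs.length w generalizing w with
  | zero => rw [cs.length_eq_zero_iff.mp hn]; exact cs.one_isPrefix w₀
  | succ n ih =>
    obtain ⟨i, hi⟩ := cs.exists_rightDescent_of_ne_one (w := w) (fun h => by simp [h] at hn)
    rw [isRightDescent_iff] at hi
    have hp := ih (w * cs.simple i) (by omega)
    obtain ⟨v, rfl⟩ : ∃ v, w = v * cs.simple i := ⟨w * cs.simple i, by simp⟩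
    rw [simple_mul_simple_cancel_right] at hi hp
    have ht : cs.IsReflection (v * cs.simple i * v⁻¹) := ⟨v, i, rfl⟩
    -- This reflection lengthens v, so the cocycle places it in v⁻¹w₀, where it becomes the left
    -- descent s_i.
    have h0 : cs.invParity v (v * cs.simple i * v⁻¹) = 0 := by
      by_contra h
      have := (cs.invParity_ne_zero_iff ht).mp h
      rw [inv_mul_cancel_right] at this
      omega
    have h1 := cs.invParity_mul v (v⁻¹ * w₀) (v * cs.simple i * v⁻¹)
    rw [mul_inv_cancel_left, h0, zero_add,
      show v⁻¹ * (v * cs.simple i * v⁻¹) * v = cs.simple i by group] at h1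
    have h2 := hrefl _ ht
    rw [h1] at h2
    exact ((cs.mul_simple_isPrefix hp).mpr (cs.length_mul_lt_of_invParity_ne_zero h2)).1

end CoxeterSystem

end

/-! ### Least common right multiples from those of generators -/

noncomputable section

/-- A left cancellative monoid with an additive length that vanishes only at `1`, in which any two
elements have a least common right multiple. -/
class GradedLcmMonoid (P : Type*) [Monoid P] where
  /-- The length. -/
  len : P → ℕ
  len_mul : ∀ a b, len (a * b) = len a + len b
  eq_one_of_len_eq_zero : ∀ a, len a = 0 → a = 1
  mul_left_cancel : ∀ a b c : P, a * b = a * c → b = c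
  exists_lcm : ∀ x y : P, ∃ r, x ∣ r ∧ y ∣ r ∧ ∀ m, x ∣ m → y ∣ m → r ∣ m

/-- Least common right multiples exist if they exist for generators. -/
theorem exists_lcm_of_generators {B P : Type*} [Monoid P] (gen : B → P) (len : P → ℕ)
    (len_mul : ∀ a b, len (a * b) = len a + len b) (len_gen : ∀ i, len (gen i) = 1)
    (exists_gen : ∀ x : P, x = 1 ∨ ∃ i y, x = gen i * y)
    (cancel : ∀ a b c : P, a * b = a * c → b = c)
    (lcm_gen : ∀ i j, ∃ s, gen i ∣ s ∧ gen j ∣ s ∧ ∀ m, gen i ∣ m → gen j ∣ m → s ∣ m)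
    {x y m : P} (hx : x ∣ m) (hy : y ∣ m) :
    ∃ r, x ∣ r ∧ y ∣ r ∧ ∀ m, x ∣ m → y ∣ m → r ∣ m := by
  have dvd_cancel : ∀ a b c : P, a * b ∣ a * c → b ∣ c := by
    rintro a b c ⟨d, hd⟩
    exact ⟨d, cancel a _ _ (by rw [hd, mul_assoc])⟩
  induction hn : len m using Nat.strong_induction_on generalizing x y m with
  | _ n ih =>
    subst hn
    rcases exists_gen x with rfl | ⟨i, x', rfl⟩
    · exact ⟨y, one_dvd y, dvd_rfl, fun _ _ h => h⟩
    rcases exists_gen y with rfl | ⟨j, y', rfl⟩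
    · exact ⟨gen i * x', dvd_rfl, one_dvd _, fun _ h _ => h⟩
    obtain ⟨s, ⟨a, ha⟩, ⟨b, hb⟩, hs⟩ := lcm_gen i j
    have him : gen i ∣ m := (dvd_mul_right _ _).trans hx
    have hjm : gen j ∣ m := (dvd_mul_right _ _).trans hy
    obtain ⟨m', hm'⟩ := hs m him hjm
    -- The lcm of gen k · z and s = gen k · c comes from that of z and c, which have a shorter
    -- common multiple. The full lcm is then s(q ∨ q').
    have extend : ∀ (k : B) (z c : P), gen k * z ∣ m → s = gen k * c →
        ∃ q, gen k * z ∣ s * q ∧ ∀ m, gen k * z ∣ m → s ∣ m → s * q ∣ m := by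
      intro k z c hz hc
      obtain ⟨n', hn'⟩ := hz
      have h1 : m = gen k * (z * n') := by rw [hn', mul_assoc]
      have h2 : c ∣ z * n' := dvd_cancel (gen k) _ _ (by rw [← hc, ← h1]; exact ⟨m', hm'⟩)
      obtain ⟨r, hzr, ⟨q, hq⟩, hr⟩ := ih (len (z * n'))
        (by rw [h1, len_mul (gen k), len_gen]; omega) (dvd_mul_right z n') h2 rfl
      refine ⟨q, ?_, fun l hl hsl => ?_⟩
      · rw [hc, mul_assoc, ← hq]; exact mul_dvd_mul_left _ hzr
      · obtain ⟨l', rfl⟩ := (dvd_mul_right (gen k) z).trans hl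
        rw [hc, mul_assoc, ← hq]
        exact mul_dvd_mul_left _ (hr l' (dvd_cancel _ _ _ hl) (dvd_cancel _ _ _ (hc ▸ hsl)))
    obtain ⟨q, hq1, hq2⟩ := extend i x' a hx ha
    obtain ⟨q', hq1', hq2'⟩ := extend j y' b hy hb
    have hsm : s ∣ m := ⟨m', hm'⟩
    have hqm : q ∣ m' := dvd_cancel s _ _ (hm' ▸ hq2 m hx hsm)
    have hqm' : q' ∣ m' := dvd_cancel s _ _ (hm' ▸ hq2' m hy hsm)
    obtain ⟨r, h1, h2, h3⟩ := ih (len m')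
      (by rw [hm', len_mul, ha, len_mul (gen i), len_gen]; omega) hqm hqm' rfl
    refine ⟨s * r, hq1.trans (mul_dvd_mul_left s h1), hq1'.trans (mul_dvd_mul_left s h2),
      fun l hl hl' => ?_⟩
    have hsl : s ∣ l := hs l ((dvd_mul_right _ _).trans hl) ((dvd_mul_right _ _).trans hl')
    obtain ⟨l', rfl⟩ := hsl
    exact mul_dvd_mul_left s (h3 l' (dvd_cancel s _ _ (hq2 _ hl (dvd_mul_right _ _)))
      (dvd_cancel s _ _ (hq2' _ hl' (dvd_mul_right _ _))))

/-! ### Greedy absorption in the weak order -/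

namespace CoxeterSystem

variable {B W : Type*} [Group W] {M : CoxeterMatrix B} (cs : CoxeterSystem M W)

theorem IsPrefix.antisymm {cs : CoxeterSystem M W} {a b : W} (h : cs.IsPrefix a b)
    (h' : cs.IsPrefix b a) : a = b := by
  have h1 := h'.length_le
  rw [IsPrefix] at h
  exact inv_mul_eq_one.mp (cs.length_eq_zero_iff.mp (by omega))

theorem mul_isPrefix_mul_iff {a b c : W} (h : cs.length (a * c) = cs.length a + cs.length c) :
    cs.IsPrefix (a * b) (a * c) ∧ cs.length (a * b) = cs.length a + cs.length b ↔
      cs.IsPrefix b c := by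
  have := cs.isPrefix_inv_mul_iff (a := a) (b := b) (cs.isPrefix_mul_iff.mpr h)
  rw [inv_mul_cancel_left] at this
  rw [this, and_comm]

/-- The meet in the weak order. -/
def meet (a b : W) : W := (cs.exists_meet a b).choose

theorem meet_isPrefix_left (a b : W) : cs.IsPrefix (cs.meet a b) a :=
  (cs.exists_meet a b).choose_spec.1

theorem meet_isPrefix_right (a b : W) : cs.IsPrefix (cs.meet a b) b :=
  (cs.exists_meet a b).choose_spec.2.1

theorem isPrefix_meet {a b z : W} (h : cs.IsPrefix z a) (h' : cs.IsPrefix z b) :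
    cs.IsPrefix z (cs.meet a b) := (cs.exists_meet a b).choose_spec.2.2 z h h'

theorem meet_one_right (a : W) : cs.meet a 1 = 1 :=
  (cs.meet_isPrefix_right a 1).antisymm (cs.one_isPrefix _)

section Finite

variable [Finite W]

/-- The longest element. -/
def longest : W := cs.exists_longest.choose

theorem isPrefix_longest (w : W) : cs.IsPrefix w cs.longest := cs.exists_longest.choose_spec w

theorem isPrefix_inv_mul_longest {a b : W} : cs.IsPrefix b (a⁻¹ * cs.longest) ↔
    cs.length (a * b) = cs.length a + cs.length b := by
  rw [cs.isPrefix_inv_mul_iff (cs.isPrefix_longest a), and_iff_left (cs.isPrefix_longest _)]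

/-- The longest prefix `z` of `w` with `ℓ(a z) = ℓ(a) + ℓ(z)`. -/
def transfer (a w : W) : W := cs.meet w (a⁻¹ * cs.longest)

theorem transfer_isPrefix (a w : W) : cs.IsPrefix (cs.transfer a w) w :=
  cs.meet_isPrefix_left _ _

theorem length_mul_transfer (a w : W) :
    cs.length (a * cs.transfer a w) = cs.length a + cs.length (cs.transfer a w) :=
  cs.isPrefix_inv_mul_longest.mp (cs.meet_isPrefix_right _ _)

theorem isPrefix_transfer {a w z : W} (h : cs.IsPrefix z w)
    (h' : cs.length (a * z) = cs.length a + cs.length z) : cs.IsPrefix z (cs.transfer a w) :=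
  cs.isPrefix_meet h (cs.isPrefix_inv_mul_longest.mpr h')

theorem transfer_one (w : W) : cs.transfer 1 w = w :=
  (cs.transfer_isPrefix 1 w).antisymm (cs.isPrefix_transfer (cs.isPrefix_refl w) (by simp))

theorem transfer_longest (w : W) : cs.transfer cs.longest w = 1 := by
  rw [transfer, inv_mul_cancel, meet_one_right]

/-- Absorbing from w into b and then into a equals absorbing into ab: by maximality each side is a
prefix of the other. This makes `germAct` multiplicative on length-additive products. -/
theorem transfer_mul_transfer {a b w : W} (h : cs.length (a * b) = cs.length a + cs.length b) :
    cs.transfer a (b * cs.transfer b w) = b * cs.transfer (a * b) w := by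
  have hx := cs.length_mul_transfer (a * b) w
  have hxw := cs.transfer_isPrefix (a * b) w
  have hz := cs.length_mul_transfer b w
  have hzw := cs.transfer_isPrefix b w
  have hy := cs.length_mul_transfer a (b * cs.transfer b w)
  have hyz := cs.transfer_isPrefix a (b * cs.transfer b w)
  set x := cs.transfer (a * b) w
  set z := cs.transfer b w with hzdef
  have hby : cs.IsPrefix b (cs.transfer a (b * z)) :=
    cs.isPrefix_transfer (cs.isPrefix_mul_iff.mpr hz) h
  set y := cs.transfer a (b * z) with hydef
  have h1 := cs.length_mul_le a (b * x)
  have h2 := cs.length_mul_le b x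
  rw [mul_assoc] at hx
  have hxz : cs.IsPrefix x z := cs.isPrefix_transfer hxw (by omega)
  obtain ⟨h3, h4⟩ := (cs.mul_isPrefix_mul_iff hz).mpr hxz
  obtain ⟨v, hv⟩ : ∃ v, y = b * v := ⟨b⁻¹ * y, by simp⟩
  rw [hv] at hby hyz hy ⊢
  rw [isPrefix_mul_iff] at hby
  have hvz : cs.IsPrefix v z := (cs.mul_isPrefix_mul_iff hz).mp ⟨hyz, hby⟩
  have hvx : cs.IsPrefix v x := cs.isPrefix_transfer (hvz.trans hzw) (by rw [mul_assoc]; omega)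
  refine IsPrefix.antisymm (cs := cs) ((cs.mul_isPrefix_mul_iff h4).mpr hvx).1 ?_
  rw [← hv]
  exact cs.isPrefix_transfer h3 (by omega)

/-- The longest element has both i and j as left descents, and its length splits along the dihedral
prefix. -/
theorem isReduced_altWord {i j : B} (hij : i ≠ j) : cs.IsReduced (altWord i j (M i j)) := by
  have hd : ∀ k, cs.IsLeftDescent cs.longest k := fun k => by
    have h := cs.isPrefix_longest (cs.simple k)
    rw [IsPrefix, cs.length_simple, inv_simple] at h
    rw [IsLeftDescent]
    omega
  obtain ⟨-, y, h1, -, h3⟩ := cs.exists_altWord_prefix hij (hd i) (hd j)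
  have h4 := cs.length_mul_le (cs.wordProd (altWord i j (M i j))) y
  rw [← h1] at h4
  have h5 := cs.length_wordProd_le (altWord i j (M i j))
  rw [IsReduced]
  rw [length_altWord] at h5 ⊢
  omega

end Finite

end CoxeterSystem

/-! ### Cancellation and least common multiples in finite-type Artin monoids -/

namespace ArtinMonoid

variable {B : Type*} {M : CoxeterMatrix B}

theorem braid (i j : B) (hij : i ≠ j) (hM : M i j ≠ 0) :
    ((altWord i j (M i j)).map (artinGen M)).prod =
      ((altWord j i (M i j)).map (artinGen M)).prod := by
  have h : PresentedMonoid.mk (ArtinRel M) = FreeMonoid.lift (artinGen M) :=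
    FreeMonoid.hom_eq fun _ => rfl
  rw [← lift_alternatingFreeWord, ← lift_alternatingFreeWord, ← h]
  exact PresentedMonoid.mk_eq_mk_of_rel (.braid i j hij hM)

/-- The homomorphism from the Artin monoid given by elements with the braid relations. -/
def lift {G : Type*} [Monoid G] (f : B → G)
    (hf : ∀ i j, i ≠ j → M i j ≠ 0 →
      ((altWord i j (M i j)).map f).prod = ((altWord j i (M i j)).map f).prod) :
    ArtinMonoid M →* G :=
  PresentedMonoid.lift f (by
    rintro _ _ ⟨i, j, hij, hM⟩
    rw [lift_alternatingFreeWord, lift_alternatingFreeWord, hf i j hij hM])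

theorem induction_left {p : ArtinMonoid M → Prop} (one : p 1)
    (mul : ∀ i x, p x → p (artinGen M i * x)) (x : ArtinMonoid M) : p x := by
  have h : x ∈ Submonoid.closure (Set.range (PresentedMonoid.of (ArtinRel M))) := by
    rw [PresentedMonoid.closure_range_of]; trivial
  induction h using Submonoid.closure_induction_left with
  | one => exact one
  | mul_left a ha y _ ih =>
    obtain ⟨i, rfl⟩ := ha
    exact mul i y ih

theorem exists_gen_mul (x : ArtinMonoid M) : x = 1 ∨ ∃ i y, x = artinGen M i * y := by
  induction x using induction_left with
  | one => exact Or.inl rfl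
  | mul i x _ => exact Or.inr ⟨i, x, rfl⟩

/-- The length of the words that represent an element. -/
def len (x : ArtinMonoid M) : ℕ :=
  (lift (fun _ => Multiplicative.ofAdd 1) (by simp [length_altWord]) x).toAdd

theorem len_mul (x y : ArtinMonoid M) : len (x * y) = len x + len y := by simp [len]

theorem len_gen (i : B) : len (artinGen M i) = 1 := rfl

theorem eq_one_of_len_eq_zero (x : ArtinMonoid M) (h : len x = 0) : x = 1 := by
  rcases exists_gen_mul x with rfl | ⟨i, y, rfl⟩
  · rfl
  · rw [len_mul, len_gen] at h
    omega

/-- The canonical section `W → A_M⁺`. -/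
def ofGroup (w : M.Group) : ArtinMonoid M := M.toCoxeterSystem.reducedLift (artinGen M) w

local notation "cs" => CoxeterMatrix.toCoxeterSystem M

theorem ofGroup_one : ofGroup (1 : M.Group) = 1 := (cs).reducedLift_one braid

theorem ofGroup_simple (i : B) : ofGroup ((cs).simple i) = artinGen M i :=
  (cs).reducedLift_simple braid i

theorem ofGroup_wordProd {ω : List B} (h : (cs).IsReduced ω) :
    ofGroup ((cs).wordProd ω) = (ω.map (artinGen M)).prod := (cs).reducedLift_wordProd braid h

theorem ofGroup_mul {a b : M.Group} (h : (cs).length (a * b) = (cs).length a + (cs).length b) :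
    ofGroup (a * b) = ofGroup a * ofGroup b := (cs).reducedLift_mul braid h

theorem ofGroup_mul_inv_mul {a b : M.Group} (h : (cs).IsPrefix a b) :
    ofGroup a * ofGroup (a⁻¹ * b) = ofGroup b := by
  rw [← ofGroup_mul, mul_inv_cancel_left]
  rwa [mul_inv_cancel_left]

section Finite

variable [Finite M.Group]

/-- Left multiplication by `a` on pairs `(w, p)` representing `ofGroup w * p`. -/
def germAct (a : M.Group) : Function.End (M.Group × ArtinMonoid M) := fun x =>
  (a * (cs).transfer a x.1, ofGroup (((cs).transfer a x.1)⁻¹ * x.1) * x.2)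

theorem germAct_one : germAct (1 : M.Group) = 1 := by
  funext x
  simp [germAct, (cs).transfer_one, ofGroup_one, Function.End.one_def]

theorem germAct_mul {a b : M.Group} (h : (cs).length (a * b) = (cs).length a + (cs).length b) :
    germAct (a * b) = germAct a * germAct b := by
  funext x
  change germAct (a * b) x = germAct a (germAct b x)
  simp only [germAct, (cs).transfer_mul_transfer h]
  refine Prod.ext (mul_assoc _ _ _) ?_
  simp only [← mul_assoc]
  congr 1
  have hz := (cs).transfer_isPrefix b x.1
  have hxw := (cs).transfer_isPrefix (a * b) x.1
  have hx := (cs).length_mul_transfer (a * b) x.1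
  set w := x.1
  set y := (cs).transfer (a * b) w
  have hxz : (cs).IsPrefix y ((cs).transfer b w) := by
    refine (cs).isPrefix_transfer hxw ?_
    have h1 := (cs).length_mul_le a (b * y)
    have h2 := (cs).length_mul_le b y
    rw [mul_assoc] at hx
    omega
  set z := (cs).transfer b w
  have e : (b * y)⁻¹ * b * z = y⁻¹ * z := by group
  rw [e, ← ofGroup_mul]
  · congr 1; group
  · have e2 : y⁻¹ * z * (z⁻¹ * w) = y⁻¹ * w := by group
    rw [e2]
    rw [CoxeterSystem.IsPrefix] at *
    omega

theorem prod_map_germAct {ω : List B} (h : (cs).IsReduced ω) :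
    (ω.map fun i => germAct ((cs).simple i)).prod = germAct ((cs).wordProd ω) := by
  induction ω with
  | nil => simp [germAct_one]
  | cons i ω ih =>
    obtain ⟨h1, h2⟩ := ((cs).isReduced_cons_iff i ω).mp h
    rw [List.map_cons, List.prod_cons, ih h1, (cs).wordProd_cons, germAct_mul]
    rw [← (cs).wordProd_cons, h.eq, h1.eq, (cs).length_simple, List.length_cons, add_comm]

/-- The action of the Artin monoid on pairs. -/
def act : ArtinMonoid M →* Function.End (M.Group × ArtinMonoid M) :=
  lift (fun i => germAct ((cs).simple i)) fun i j hij hM => by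
    have h2 := (cs).isReduced_altWord hij.symm
    rw [M.symmetric j i] at h2
    rw [prod_map_germAct ((cs).isReduced_altWord hij), prod_map_germAct h2,
      (cs).wordProd_altWord_comm]

theorem act_ofGroup (w : M.Group) : act (ofGroup w) = germAct w := by
  obtain ⟨ω, hω, rfl⟩ := (cs).exists_isReduced w
  rw [ofGroup_wordProd hω, map_list_prod, List.map_map, ← prod_map_germAct hω]
  rfl

/-- The action only regroups factors. At (1, 1) it splits x into its head and a remainder. -/
theorem ofGroup_act (x : ArtinMonoid M) (y : M.Group × ArtinMonoid M) :
    ofGroup (act x y).1 * (act x y).2 = x * (ofGroup y.1 * y.2) := by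
  induction x using induction_left with
  | one => simp [Function.End.one_def]
  | mul i x ih =>
    rw [mul_assoc, ← ih, map_mul]
    change ofGroup (germAct ((cs).simple i) (act x y)).1 *
      (germAct ((cs).simple i) (act x y)).2 = _
    simp only [germAct]
    rw [ofGroup_mul ((cs).length_mul_transfer _ _), ofGroup_simple, mul_assoc,
      ← mul_assoc (ofGroup _) (ofGroup _), ofGroup_mul_inv_mul ((cs).transfer_isPrefix _ _)]

/-- The longest element absorbs nothing, so acting by it on a pair leaves the whole product as
second component: x can be read off from Δx. -/
theorem ofGroup_longest_mul_cancel {x y : ArtinMonoid M}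
    (h : ofGroup (cs).longest * x = ofGroup (cs).longest * y) : x = y := by
  have key : ∀ x : ArtinMonoid M, (act (ofGroup (cs).longest * x) (1, 1)).2 = x := by
    intro x
    rw [map_mul]
    change (act (ofGroup (cs).longest) (act x (1, 1))).2 = x
    have := ofGroup_act x (1, 1)
    simp only [ofGroup_one, mul_one] at this
    simpa [act_ofGroup, germAct, (cs).transfer_longest] using this
  rw [← key x, h, key]

/-- Every generator is a right factor of Δ, so cancelling Δ cancels generators one by one. -/
theorem mul_left_cancel (a x y : ArtinMonoid M) (h : a * x = a * y) : x = y := by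
  induction a using induction_left with
  | one => simpa using h
  | mul i a ih =>
    apply ih
    apply ofGroup_longest_mul_cancel
    have hl : (cs).length ((cs).longest * (cs).simple i) + 1 = (cs).length (cs).longest := by
      have h1 := ((cs).isPrefix_longest ((cs).longest * (cs).simple i)).length_le
      have h2 := (cs).length_mul_simple (cs).longest i
      omega
    have e : ofGroup (cs).longest =
        ofGroup ((cs).longest * (cs).simple i) * artinGen M i := by
      rw [← ofGroup_simple, ← ofGroup_mul]
      · rw [(cs).simple_mul_simple_cancel_right]
      · rw [(cs).simple_mul_simple_cancel_right, (cs).length_simple, hl]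
    rw [e, mul_assoc, mul_assoc, ← mul_assoc (artinGen M i), h, mul_assoc]

/-- The greatest left divisor of `x` in the image of the Coxeter group. -/
def head (x : ArtinMonoid M) : M.Group := (act x (1, 1)).1

theorem ofGroup_dvd {w : M.Group} {x : ArtinMonoid M} (h : (cs).IsPrefix w (head x)) :
    ofGroup w ∣ x := by
  have := ofGroup_act x (1, 1)
  simp only [ofGroup_one, mul_one] at this
  change ofGroup (head x) * _ = x at this
  rw [← ofGroup_mul_inv_mul h, mul_assoc] at this
  exact ⟨_, this.symm⟩

theorem simple_isPrefix_head {i : B} {x : ArtinMonoid M} (h : artinGen M i ∣ x) :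
    (cs).IsPrefix ((cs).simple i) (head x) := by
  obtain ⟨y, rfl⟩ := h
  rw [head, map_mul]
  exact (cs).isPrefix_mul_iff.mpr ((cs).length_mul_transfer _ _)

theorem exists_lcm_gen (i j : B) : ∃ s, artinGen M i ∣ s ∧ artinGen M j ∣ s ∧
    ∀ m, artinGen M i ∣ m → artinGen M j ∣ m → s ∣ m := by
  rcases eq_or_ne i j with rfl | hij
  · exact ⟨_, dvd_rfl, dvd_rfl, fun _ h _ => h⟩
  have hr := (cs).isReduced_altWord hij
  have hgen : ∀ k, artinGen M k ∣ ofGroup (cs).longest := fun k => by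
    rw [← ofGroup_mul_inv_mul ((cs).isPrefix_longest ((cs).simple k)), ofGroup_simple]
    exact dvd_mul_right _ _
  have key : ∀ m : ArtinMonoid M, artinGen M i ∣ m → artinGen M j ∣ m →
      M i j ≠ 0 ∧ ofGroup ((cs).wordProd (altWord i j (M i j))) ∣ m := by
    intro m hi hj
    have := (cs).mul_altWord_isPrefix (z := 1) (x := head m) hij
      (by simpa using simple_isPrefix_head hi) (by simpa using simple_isPrefix_head hj)
      (by rw [one_mul, (cs).length_simple, (cs).length_one])
      (by rw [one_mul, (cs).length_simple, (cs).length_one])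
    rw [one_mul] at this
    exact ⟨this.2.2, ofGroup_dvd this.1⟩
  -- Applied to Δ, a common multiple of both generators, this shows m_ij < ∞.
  have hM := (key _ (hgen i) (hgen j)).1
  obtain ⟨m, hm⟩ := Nat.exists_eq_succ_of_ne_zero hM
  refine ⟨_, ?_, ?_, fun m hi hj => (key m hi hj).2⟩
  · rw [ofGroup_wordProd hr, hm, altWord, List.map_cons, List.prod_cons]
    exact dvd_mul_right _ _
  · rw [ofGroup_wordProd hr, braid i j hij hM, hm, altWord, List.map_cons, List.prod_cons]
    exact dvd_mul_right _ _

/-- To pass a generator e_i, apply induction to the complement s_i⁻¹w₀: then e_i times its lift is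
Δ, which w divides. -/
theorem exists_mul_ofGroup_eq (w : M.Group) (x : ArtinMonoid M) :
    ∃ y v, ofGroup w * y = x * ofGroup v := by
  induction x using induction_left generalizing w with
  | one => exact ⟨1, w, by simp⟩
  | mul i x ih =>
    obtain ⟨y, v, h⟩ := ih (((cs).simple i)⁻¹ * (cs).longest)
    refine ⟨ofGroup (w⁻¹ * (cs).longest) * y, v, ?_⟩
    rw [← mul_assoc, ofGroup_mul_inv_mul ((cs).isPrefix_longest w), mul_assoc, ← h, ← mul_assoc,
      ← ofGroup_simple, ofGroup_mul_inv_mul ((cs).isPrefix_longest _)]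

theorem exists_common_multiple (x y : ArtinMonoid M) : ∃ m, x ∣ m ∧ y ∣ m := by
  induction y using induction_left generalizing x with
  | one => exact ⟨x, dvd_rfl, one_dvd x⟩
  | mul i y ih =>
    obtain ⟨z, v, h⟩ := exists_mul_ofGroup_eq ((cs).simple i) x
    obtain ⟨m, ⟨a, ha⟩, hy⟩ := ih z
    refine ⟨artinGen M i * m, ?_, mul_dvd_mul_left _ hy⟩
    rw [ha, ← mul_assoc, ← ofGroup_simple, h, mul_assoc]
    exact dvd_mul_right _ _

instance : GradedLcmMonoid (ArtinMonoid M) where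
  len := len
  len_mul := len_mul
  eq_one_of_len_eq_zero := eq_one_of_len_eq_zero
  mul_left_cancel := mul_left_cancel
  exists_lcm x y := by
    obtain ⟨m, hx, hy⟩ := exists_common_multiple x y
    exact exists_lcm_of_generators (artinGen M) len len_mul len_gen exists_gen_mul mul_left_cancel
      exists_lcm_gen hx hy

end Finite

end ArtinMonoid

end

/-! ### Residuals and the calculus of joins -/

noncomputable section

namespace GradedLcmMonoid

variable {P : Type*} [Monoid P] [GradedLcmMonoid P]

theorem mul_cancel {a b c : P} : a * b = a * c ↔ b = c :=
  ⟨mul_left_cancel a b c, fun h => h ▸ rfl⟩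

theorem mul_dvd_mul_iff {a b c : P} : a * b ∣ a * c ↔ b ∣ c := by
  refine ⟨?_, mul_dvd_mul_left a⟩
  rintro ⟨d, hd⟩
  rw [mul_assoc, mul_cancel] at hd
  exact ⟨d, hd⟩

theorem dvd_antisymm {a b : P} (h : a ∣ b) (h' : b ∣ a) : a = b := by
  obtain ⟨c, rfl⟩ := h
  obtain ⟨d, hd⟩ := h'
  have : len a = len a + len c + len d := by rw [← len_mul, ← len_mul, ← hd]
  rw [eq_one_of_len_eq_zero c (by omega), mul_one]

theorem len_lt_of_dvd {a b : P} (h : a ∣ b) (hne : ¬ b ∣ a) : len a < len b := by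
  obtain ⟨c, rfl⟩ := h
  rw [len_mul]
  by_contra hc
  rw [eq_one_of_len_eq_zero c (by omega), mul_one] at hne
  exact hne dvd_rfl

/-- The least common right multiple. -/
def join (x y : P) : P := (exists_lcm x y).choose

theorem dvd_join_left (x y : P) : x ∣ join x y := (exists_lcm x y).choose_spec.1

theorem dvd_join_right (x y : P) : y ∣ join x y := (exists_lcm x y).choose_spec.2.1

theorem join_dvd {x y m : P} (hx : x ∣ m) (hy : y ∣ m) : join x y ∣ m :=
  (exists_lcm x y).choose_spec.2.2 m hx hy

theorem join_dvd_iff {x y m : P} : join x y ∣ m ↔ x ∣ m ∧ y ∣ m :=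
  ⟨fun h => ⟨(dvd_join_left x y).trans h, (dvd_join_right x y).trans h⟩, fun h => join_dvd h.1 h.2⟩

theorem eq_of_dvd_iff {a b : P} (h : ∀ m, a ∣ m ↔ b ∣ m) : a = b :=
  dvd_antisymm ((h b).mpr dvd_rfl) ((h a).mp dvd_rfl)

theorem join_comm (x y : P) : join x y = join y x :=
  eq_of_dvd_iff fun m => by simp only [join_dvd_iff, and_comm]

theorem join_assoc (x y z : P) : join (join x y) z = join x (join y z) :=
  eq_of_dvd_iff fun m => by simp only [join_dvd_iff, and_assoc]

theorem join_eq_left {x y : P} (h : y ∣ x) : join x y = x :=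
  dvd_antisymm (join_dvd dvd_rfl h) (dvd_join_left x y)

theorem join_eq_right {x y : P} (h : x ∣ y) : join x y = y := by
  rw [join_comm, join_eq_left h]

theorem mul_join (p x y : P) : join (p * x) (p * y) = p * join x y := by
  refine dvd_antisymm (join_dvd (mul_dvd_mul_left p (dvd_join_left x y))
    (mul_dvd_mul_left p (dvd_join_right x y))) ?_
  obtain ⟨m, hm⟩ := (dvd_mul_right p x).trans (dvd_join_left (p * x) (p * y))
  rw [hm]
  refine mul_dvd_mul_left p (join_dvd ?_ ?_)
  · rw [← mul_dvd_mul_iff (a := p), ← hm]; exact dvd_join_left _ _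
  · rw [← mul_dvd_mul_iff (a := p), ← hm]; exact dvd_join_right _ _

/-- The residual `x⁻¹ (x ∨ y)`. -/
def residual (x y : P) : P := (dvd_join_left x y).choose

theorem mul_residual (x y : P) : x * residual x y = join x y :=
  (dvd_join_left x y).choose_spec.symm

theorem residual_eq {x y a : P} (h : x * a = join x y) : residual x y = a :=
  mul_left_cancel x _ _ (by rw [mul_residual, h])

theorem residual_eq_one {x y : P} (h : y ∣ x) : residual x y = 1 :=
  residual_eq (by rw [mul_one, join_eq_left h])

theorem one_residual (y : P) : residual 1 y = y :=
  residual_eq (by rw [one_mul, join_eq_right (one_dvd y)])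

theorem mul_join_residual (p q x : P) : p * join q (residual p x) = join (p * q) x := by
  rw [← mul_join, mul_residual, ← join_assoc, join_eq_left (dvd_mul_right p q)]

theorem mul_residual_left (p q x : P) : residual (p * q) x = residual q (residual p x) :=
  residual_eq (by rw [mul_assoc, mul_residual, mul_join_residual])

theorem residual_mul_residual (r x y : P) :
    residual r x * residual (join r x) y = residual r (join x y) :=
  (residual_eq (by rw [← mul_assoc, mul_residual, mul_residual, join_assoc])).symm

theorem residual_mul_right (x b y : P) :
    residual x (b * y) = residual x b * residual (residual b x) y := by
  refine residual_eq ?_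
  rw [← mul_assoc, mul_residual, join_comm x b, ← mul_residual b x, mul_assoc, mul_residual,
    join_comm (residual b x), mul_join_residual, join_comm]

/-! ### Finite sets closed under joins -/

theorem exists_join_closed (A : List P) :
    ∃ S : Finset P, (∀ a ∈ A, a ∈ S) ∧ ∀ x ∈ S, ∀ y ∈ S, join x y ∈ S := by
  classical
  induction A with
  | nil => exact ⟨∅, by simp, by simp⟩
  | cons a A ih =>
    obtain ⟨S, hA, hS⟩ := ih
    have haa : join a a = a := join_eq_left dvd_rfl
    have hjoin (x y : P) : join (join a x) y = join a (join x y) := join_assoc _ _ _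
    have hj (y : P) : join a (join a y) = join a y := by rw [← join_assoc, haa]
    have hl (x y : P) : join x (join a y) = join a (join x y) := by
      rw [← join_assoc, join_comm x a, join_assoc]
    -- Joins are idempotent, commutative and associative, so adjoining a and all a ∨ x is enough.
    refine ⟨insert a (S ∪ S.image (join a)), ?_, ?_⟩
    · intro b hb
      rcases List.mem_cons.mp hb with rfl | hb
      · simp
      · simp [hA b hb]
    · intro x hx y hy
      simp only [Finset.mem_insert, Finset.mem_union, Finset.mem_image] at hx hy ⊢
      rcases hx with rfl | hx | ⟨x, hx, rfl⟩ <;> rcases hy with rfl | hy | ⟨y, hy, rfl⟩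
      · exact Or.inl haa
      · exact Or.inr (Or.inr ⟨y, hy, rfl⟩)
      · exact Or.inr (Or.inr ⟨y, hy, (hj y).symm⟩)
      · exact Or.inr (Or.inr ⟨x, hx, join_comm _ _⟩)
      · exact Or.inr (Or.inl (hS x hx y hy))
      · exact Or.inr (Or.inr ⟨_, hS x hx y hy, (hl x y).symm⟩)
      · exact Or.inr (Or.inr ⟨x, hx, by rw [join_comm (join y x), hj]⟩)
      · exact Or.inr (Or.inr ⟨_, hS x hx y hy, (hjoin x y).symm⟩)
      · exact Or.inr (Or.inr ⟨_, hS x hx y hy, by rw [hjoin, hl, hj]⟩)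

theorem exists_sorted_list (S : Finset P) :
    ∃ L : List P, (∀ x, x ∈ L ↔ x ∈ S) ∧ L.Pairwise fun x y => len x ≤ len y := by
  classical
  refine Finset.induction_on_min_value len (s := S) ?_ ?_
  · exact ⟨[], by simp, List.Pairwise.nil⟩
  · rintro a S ha hmin ⟨L, hL, hs⟩
    exact ⟨a :: L, by simp [hL], List.pairwise_cons.mpr ⟨fun x hx => hmin x ((hL x).mp hx), hs⟩⟩

/-! ### Joins in terms of ideals -/

theorem mem_principalRightIdeal {P : Type*} [Monoid P] {p m : P} : m ∈ principalRightIdeal p ↔ p ∣ m := by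
  simp only [principalRightIdeal, Set.mem_range, Dvd.dvd, eq_comm]

theorem mem_joinSet_iff {P : Type*} [Monoid P] {F : Set P} {s : P} :
    s ∈ joinSet F ↔ ∀ m, s ∣ m ↔ ∀ x ∈ F, x ∣ m := by
  rw [joinSet, Set.mem_ofPred_eq, Set.ext_iff]
  simp only [Set.mem_iInter, mem_principalRightIdeal]
  exact forall_congr' fun m => iff_comm

theorem eq_of_mem_joinSet {F : Set P} {s t : P} (hs : s ∈ joinSet F) (ht : t ∈ joinSet F) :
    s = t :=
  eq_of_dvd_iff fun m => (mem_joinSet_iff.mp hs m).trans (mem_joinSet_iff.mp ht m).symm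

theorem mem_joinSet_pair {p q s : P} : s ∈ joinSet {p, q} ↔ s = join p q := by
  have h : join p q ∈ joinSet {p, q} := mem_joinSet_iff.mpr fun m => by simp [join_dvd_iff]
  exact ⟨fun hs => eq_of_mem_joinSet hs h, fun hs => hs ▸ h⟩

theorem joinSet_insert_insert (r x : P) (U : Set P) :
    joinSet (insert r (insert x U)) = joinSet (insert (join r x) U) := by
  ext s
  simp only [mem_joinSet_iff, Set.forall_mem_insert, join_dvd_iff, and_assoc]

theorem joinSet_insert_one {P : Type*} [Monoid P] (U : Set P) : joinSet (insert 1 U) = joinSet U := by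
  ext s
  simp only [mem_joinSet_iff, Set.forall_mem_insert, one_dvd, true_and]

theorem mem_joinSet_singleton {P : Type*} [Monoid P] (r : P) : r ∈ joinSet {r} :=
  mem_joinSet_iff.mpr fun m => by simp

variable {H : Type*} [NormedAddCommGroup H] [InnerProductSpace ℂ H] [CompleteSpace H]

theorem joinProj_eq (T : P →* (H →L[ℂ] H)) {U : Set P} {s : P} (hs : s ∈ joinSet U) :
    joinProj T U = T s * star (T s) := by
  have h : (joinSet U).Nonempty := ⟨s, hs⟩
  rw [joinProj, dif_pos h, eq_of_mem_joinSet h.some_mem hs]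
  rfl

theorem joinProj_congr {P : Type*} [Monoid P] (T : P →* (H →L[ℂ] H)) {U U' : Set P} (h : joinSet U = joinSet U') :
    joinProj T U = joinProj T U' := by
  unfold joinProj
  rw [h]

/-! ### Brehmer operators of lists -/

/-- The operator `Z({r⁻¹(r ∨ x) : x ∈ L})`, defined by recursion on `L`. -/
def brehmerList (T : P →* (H →L[ℂ] H)) : List P → P → (H →L[ℂ] H)
  | [], _ => 1
  | x :: L, r => brehmerList T L r -
      T (residual r x) * brehmerList T L (join r x) * star (T (residual r x))

variable (T : P →* (H →L[ℂ] H))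

theorem brehmerList_cons (x : P) (L : List P) (r : P) :
    brehmerList T (x :: L) r = brehmerList T L r -
      T (residual r x) * brehmerList T L (join r x) * star (T (residual r x)) := rfl

/-- The entry x has residual 1 and subtracts the remaining operator from itself; other entries only
replace r by multiples of r. -/
theorem brehmerList_eq_zero {L : List P} {r x : P} (hx : x ∈ L) (h : x ∣ r) :
    brehmerList T L r = 0 := by
  induction L generalizing r with
  | nil => simp at hx
  | cons y L ih =>
    rw [brehmerList_cons]
    rcases List.mem_cons.mp hx with rfl | hx
    · rw [residual_eq_one h, join_eq_left h, map_one, star_one, one_mul, mul_one, sub_self]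
    · rw [ih hx h, ih hx (h.trans (dvd_join_left r y)), mul_zero, zero_mul, sub_zero]

theorem brehmerList_perm {L L' : List P} (h : L.Perm L') (r : P) :
    brehmerList T L r = brehmerList T L' r := by
  induction h generalizing r with
  | nil => rfl
  | cons x _ ih => rw [brehmerList_cons, brehmerList_cons, ih, ih]
  | swap x y L =>
    have key : ∀ x y : P,
        T (residual r x) * (T (residual (join r x) y) * brehmerList T L (join (join r x) y) *
          star (T (residual (join r x) y))) * star (T (residual r x)) =
        T (residual r (join x y)) * brehmerList T L (join r (join x y)) *
          star (T (residual r (join x y))) := by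
      intro x y
      rw [← residual_mul_residual, map_mul, star_mul, join_assoc]
      simp only [mul_assoc]
    simp only [brehmerList_cons, mul_sub, sub_mul]
    rw [key, key, join_comm x y]
    abel
  | trans _ _ ih₁ ih₂ => rw [ih₁, ih₂]

theorem brehmerList_map_residual (L : List P) (p q : P) :
    brehmerList T (L.map (residual p)) q = brehmerList T L (p * q) := by
  induction L generalizing q with
  | nil => rfl
  | cons x L ih =>
    rw [List.map_cons, brehmerList_cons, brehmerList_cons, ih, ih, mul_join_residual,
      mul_residual_left]

/-- Telescoping: 1 - T(pq)T(pq)^* = (1 - T(p)T(p)^*) + T(p)(1 - T(q)T(q)^*)T(p)^*, relative to L.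
This shortens entries until only generators remain. -/
theorem brehmerList_mul_cons (p q : P) (L : List P) :
    brehmerList T (p * q :: L) 1 = brehmerList T (p :: L) 1 +
      T p * brehmerList T (q :: L.map (residual p)) 1 * star (T p) := by
  simp only [brehmerList_cons, one_residual, join_eq_right (one_dvd _), brehmerList_map_residual,
    mul_one, map_mul, star_mul, mul_sub, sub_mul, mul_assoc]
  abel

open Classical in
theorem brehmerList_dedup (L : List P) (r : P) :
    brehmerList T L.dedup r = brehmerList T L r := by
  induction L generalizing r with
  | nil => rfl
  | cons x L ih =>
    by_cases hx : x ∈ L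
    · rw [List.dedup_cons_of_mem hx, ih, brehmerList_cons,
        brehmerList_eq_zero T hx (dvd_join_right r x), mul_zero, zero_mul, sub_zero]
    · rw [List.dedup_cons_of_notMem hx, brehmerList_cons, brehmerList_cons, ih, ih]

/-- Positivity of the Brehmer operators of all lists follows from the lists of generators. -/
theorem brehmerList_nonneg_of_generators (G : Set P) (hlen : ∀ g ∈ G, len g ≠ 0)
    (hG : ∀ x : P, x = 1 ∨ ∃ g ∈ G, ∃ y, x = g * y)
    (h : ∀ L : List P, L.Nodup → (∀ x ∈ L, x ∈ G) → 0 ≤ brehmerList T L 1) (L : List P) :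
    0 ≤ brehmerList T L 1 := by
  classical
  -- Lexicographic induction on the length of a common multiple m and the total length of L.
  -- Splitting g·y leaves a list of smaller total length with the same m, and a list of residuals
  -- with common multiple g⁻¹m.
  have key : ∀ n, ∀ m : P, len m = n → ∀ k, ∀ L : List P, (L.map len).sum = k →
      (∀ x ∈ L, x ∣ m) → 0 ≤ brehmerList T L 1 := by
    intro n
    induction n using Nat.strong_induction_on with
    | _ n ihn =>
      intro m hm k
      induction k using Nat.strong_induction_on with
      | _ k ihk =>
        intro L hk hL
        by_cases h1 : (1 : P) ∈ L
        · rw [brehmerList_eq_zero T h1 dvd_rfl]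
        by_cases hLG : ∀ x ∈ L, x ∈ G
        · rw [← brehmerList_dedup]
          exact h _ L.nodup_dedup fun x hx => hLG x (List.mem_dedup.mp hx)
        push Not at hLG
        obtain ⟨x, hxL, hxG⟩ := hLG
        obtain ⟨g, hg, y, rfl⟩ := (hG x).resolve_left fun h => h1 (h ▸ hxL)
        have hy : len y ≠ 0 := fun hy => by
          rw [eq_one_of_len_eq_zero y hy, mul_one] at hxG
          exact hxG hg
        have hperm := List.perm_cons_erase hxL
        have hsum := (hperm.map len).sum_eq
        rw [hk, List.map_cons, List.sum_cons, len_mul] at hsum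
        have hsub : ∀ z ∈ L.erase (g * y), z ∣ m := fun z hz => hL z (List.mem_of_mem_erase hz)
        have hgm : g ∣ m := (dvd_mul_right g y).trans (hL _ hxL)
        rw [brehmerList_perm T hperm, brehmerList_mul_cons]
        refine add_nonneg (ihk (len g + ((L.erase (g * y)).map len).sum) (by omega) _ (by simp) ?_)
          (star_right_conjugate_nonneg ?_ _)
        · intro z hz
          rcases List.mem_cons.mp hz with rfl | hz
          · exact hgm
          · exact hsub z hz
        · obtain ⟨m', rfl⟩ := hgm
          have := hlen g hg
          refine ihn (len m') (by rw [← hm, len_mul]; omega) m' rfl _ _ rfl ?_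
          intro z hz
          rcases List.mem_cons.mp hz with rfl | hz
          · exact mul_dvd_mul_iff.mp (hL _ hxL)
          · obtain ⟨w, hw, rfl⟩ := List.mem_map.mp hz
            rw [← mul_dvd_mul_iff (a := g), mul_residual]
            exact join_dvd (dvd_mul_right _ _) (hsub w hw)
  obtain ⟨S, hS, hcl⟩ := exists_join_closed L
  have hub : ∃ m : P, ∀ x ∈ L, x ∣ m := by
    clear * -
    induction L with
    | nil => exact ⟨1, by simp⟩
    | cons x L ih =>
      obtain ⟨m, hm⟩ := ih
      refine ⟨join x m, fun y hy => ?_⟩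
      rcases List.mem_cons.mp hy with rfl | hy
      · exact dvd_join_left _ _
      · exact (hm y hy).trans (dvd_join_right _ _)
  obtain ⟨m, hm⟩ := hub
  exact key _ m rfl _ L rfl hm

-- Conjugation by T(r) turns residuals into joins with r; the recursion then splits subsets by
-- whether they contain x.
open Classical in
theorem mul_brehmerList_mul_star (L : List P) (hL : L.Nodup) (r : P) :
    T r * brehmerList T L r * star (T r) =
      ∑ U ∈ L.toFinset.powerset, (-1 : ℂ) ^ U.card • joinProj T (insert r (U : Set P)) := by
  induction L generalizing r with
  | nil => simp [brehmerList, joinProj_eq T (mem_joinSet_singleton r)]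
  | cons x L ih =>
    obtain ⟨hx, hL⟩ := List.nodup_cons.mp hL
    have hx' : x ∉ L.toFinset := by simpa using hx
    have e : T r * (T (residual r x) * brehmerList T L (join r x) * star (T (residual r x))) *
        star (T r) = T (join r x) * brehmerList T L (join r x) * star (T (join r x)) := by
      rw [← mul_residual r x, map_mul, star_mul]
      simp only [mul_assoc]
    rw [brehmerList_cons, mul_sub, sub_mul, e, ih hL, ih hL, List.toFinset_cons,
      Finset.sum_powerset_insert hx', sub_eq_add_neg, ← Finset.sum_neg_distrib]
    congr 1
    refine Finset.sum_congr rfl fun U hU => ?_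
    have hxU : x ∉ U := fun h => hx' (Finset.mem_powerset.mp hU h)
    rw [Finset.card_insert_of_notMem hxU, Finset.coe_insert,
      joinProj_congr T (joinSet_insert_insert r x U), pow_succ, mul_neg_one, neg_smul]

theorem brehmerZ_eq (F : Finset P) : brehmerZ T F = brehmerList T F.toList 1 := by
  classical
  have h := mul_brehmerList_mul_star T F.toList F.nodup_toList 1
  rw [map_one, one_mul, star_one, mul_one, Finset.toList_toFinset] at h
  rw [h, brehmerZ]
  exact Finset.sum_congr rfl fun U _ => by rw [joinProj_congr T (joinSet_insert_one (U : Set P))]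

/-! ### The regular kernel -/

/-- The kernel `K(p, q) = T(p⁻¹s) T(q⁻¹s)^*` with `s = p ∨ q`. -/
def regularKernel (p q : P) : H →L[ℂ] H := T (residual p q) * star (T (residual q p))

theorem isRegularKernel_regularKernel : IsRegularKernel T (regularKernel T) := by
  refine ⟨fun p q s a b hs ha hb => ?_, fun p q h => ?_⟩
  · rw [mem_joinSet_pair] at hs
    rw [regularKernel, residual_eq (ha.trans hs), residual_eq ((hb.trans hs).trans (join_comm p q))]
    rfl
  · exact absurd (mem_joinSet_pair.mpr rfl) (h ▸ Set.notMem_empty (join p q))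

theorem isStarRegular_iff : IsStarRegular T ↔ IsCompletelyPositiveDefinite (regularKernel T) :=
  ⟨fun ⟨_, hK, h⟩ => hK.unique (isRegularKernel_regularKernel T) ▸ h,
    fun h => ⟨_, isRegularKernel_regularKernel T, h⟩⟩

-- One Cholesky step per entry q. With r = p_i ∨ p_j, prepending q adds T(r⁻¹(r ∨ q)) Z(L, r ∨ q)
-- T(r⁻¹(r ∨ q))^*. The hypothesis leaves two cases: r ∣ q, which collects into a quadratic form of
-- Z(L, q), or Z(L, r ∨ q) = 0.
open Classical in
theorem sum_inner_one_sub_brehmerList_nonneg (h : ∀ L : List P, 0 ≤ brehmerList T L 1) {n : ℕ}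
    (p : Fin n → P) (v : Fin n → H) (L : List P)
    (hL : ∀ L₁ q L₂, L = L₁ ++ q :: L₂ → ∀ i j, join (p i) (p j) ∣ q ∨
      ∃ l ∈ L₂, l ∣ join (join (p i) (p j)) q) :
    0 ≤ ∑ i, ∑ j, inner ℂ (v i) ((T (residual (p i) (p j)) *
      (1 - brehmerList T L (join (p i) (p j))) * star (T (residual (p j) (p i)))) (v j)) := by
  induction L with
  | nil => simp [brehmerList]
  | cons q L ih =>
    have ih' := ih fun L₁ q' L₂ e => hL (q :: L₁) q' L₂ (by rw [e, List.cons_append])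
    set g : H := ∑ i, if p i ∣ q then star (T (residual (p i) q)) (v i) else 0 with hg
    have hpos : 0 ≤ inner ℂ g (brehmerList T L q g) := by
      -- Z(L, q) is the Brehmer operator at 1 of the residuals of L by q.
      have h0 : 0 ≤ brehmerList T L q := by
        rw [← mul_one q, ← brehmerList_map_residual]; exact h _
      exact ((ContinuousLinearMap.nonneg_iff_isPositive _).mp h0).inner_nonneg_right g
    refine (add_nonneg ih' hpos).trans_eq ?_
    rw [hg, map_sum, sum_inner, ← Finset.sum_add_distrib]
    refine Finset.sum_congr rfl fun i _ => ?_
    rw [inner_sum, ← Finset.sum_add_distrib]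
    refine Finset.sum_congr rfl fun j _ => ?_
    set r := join (p i) (p j) with hr
    have e1 : (1 : H →L[ℂ] H) - brehmerList T (q :: L) r = (1 - brehmerList T L r) +
        T (residual r q) * brehmerList T L (join r q) * star (T (residual r q)) := by
      rw [brehmerList_cons]; abel
    rw [e1, mul_add, add_mul, add_apply, inner_add_right]
    congr 1
    by_cases hrq : r ∣ q
    · obtain ⟨hi, hj⟩ := join_dvd_iff.mp hrq
      have ei : T (residual (p i) (p j)) * T (residual r q) = T (residual (p i) q) := by
        rw [← map_mul, residual_mul_residual, join_eq_right hj]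
      have ej : T (residual (p j) (p i)) * T (residual r q) = T (residual (p j) q) := by
        rw [← map_mul, hr, join_comm, residual_mul_residual, join_eq_right hi]
      rw [if_pos hi, if_pos hj, join_eq_right hrq, ← ei, ← ej, star_mul, star_mul]
      have hst (A : H →L[ℂ] H) (x y : H) : inner ℂ (star A x) y = inner ℂ x (A y) :=
        ContinuousLinearMap.adjoint_inner_left A y x
      rw [mul_apply_eq_comp, hst, hst]
      rfl
    · obtain ⟨l, hl, hlr⟩ := (hL [] q L rfl i j).resolve_left hrq
      rw [brehmerList_eq_zero T hl hlr]
      have : ¬ (p i ∣ q ∧ p j ∣ q) := fun h => hrq (join_dvd h.1 h.2)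
      by_cases hi : p i ∣ q
      · have hj : ¬ p j ∣ q := fun hj => this ⟨hi, hj⟩
        simp [hj]
      · simp [hi]

/-- In a join-closed set sorted by length, r ∨ q comes after q unless r ∣ q. As r itself is listed,
Z(L, r) = 0 and the accumulated sum is the kernel. -/
theorem isCompletelyPositiveDefinite_regularKernel (h : ∀ L : List P, 0 ≤ brehmerList T L 1) :
    IsCompletelyPositiveDefinite (regularKernel T) := by
  intro n p v
  obtain ⟨S, hpS, hS⟩ := exists_join_closed (List.ofFn p)
  obtain ⟨L, hLS, hsorted⟩ := exists_sorted_list S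
  have hp : ∀ i, p i ∈ S := fun i => hpS _ (List.mem_ofFn.mpr ⟨i, rfl⟩)
  refine (sum_inner_one_sub_brehmerList_nonneg T h p v L ?_).trans_eq ?_
  · rintro L₁ q L₂ rfl i j
    rw [or_iff_not_imp_left]
    intro hq
    have hqS : q ∈ S := (hLS q).mp (by simp)
    have hmem := (hLS _).mpr (hS _ (hS _ (hp i) _ (hp j)) q hqS)
    have hlt : len q < len (join (join (p i) (p j)) q) :=
      len_lt_of_dvd (dvd_join_right _ _) fun h => hq ((dvd_join_left _ _).trans h)
    refine ⟨_, ?_, dvd_rfl⟩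
    rcases List.mem_append.mp hmem with h1 | h1
    · have := (List.pairwise_append.mp hsorted).2.2 _ h1 q (by simp)
      omega
    · rcases List.mem_cons.mp h1 with h1 | h1
      · rw [h1] at hlt; omega
      · exact h1
  · refine Finset.sum_congr rfl fun i _ => Finset.sum_congr rfl fun j _ => ?_
    rw [brehmerList_eq_zero T ((hLS _).mpr (hS _ (hp i) _ (hp j))) dvd_rfl, sub_zero, mul_one]
    rfl

end GradedLcmMonoid

end

/-! ### Kolmogorov spaces and the construction of the dilation -/

noncomputable section

section Extension

variable {ι E F : Type*} [NormedAddCommGroup E] [InnerProductSpace ℂ E]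
  [NormedAddCommGroup F] [InnerProductSpace ℂ F]

theorem eq_of_inner_span_eq {s : Set E} (hs : Dense (Submodule.span ℂ s : Set E)) {x y : E}
    (h : ∀ a ∈ s, inner ℂ a x = inner ℂ a y) : x = y := by
  refine hs.eq_of_inner_right ℂ fun v hv => ?_
  induction hv using Submodule.span_induction with
  | mem a ha => exact h a ha
  | zero => rw [inner_zero_left, inner_zero_left]
  | add a b _ _ ha hb => rw [inner_add_left, inner_add_left, ha, hb]
  | smul c a _ ha => rw [inner_smul_left, inner_smul_left, ha]

theorem inner_linearCombination_eq {a : ι → E} {b : ι → F}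
    (h : ∀ i j, inner ℂ (a i) (a j) = inner ℂ (b i) (b j)) (f g : ι →₀ ℂ) :
    inner ℂ (Finsupp.linearCombination ℂ a f) (Finsupp.linearCombination ℂ a g) =
      inner ℂ (Finsupp.linearCombination ℂ b f) (Finsupp.linearCombination ℂ b g) := by
  simp only [Finsupp.linearCombination_apply, Finsupp.sum_inner, Finsupp.inner_sum, inner_smul_left,
    inner_smul_right, h]

/-- A map with the same Gram matrix as a total family extends to an isometry. -/
theorem exists_isometry_extending [CompleteSpace F] {a : ι → E} {b : ι → F}
    (ha : Dense (Submodule.span ℂ (Set.range a) : Set E))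
    (h : ∀ i j, inner ℂ (a i) (a j) = inner ℂ (b i) (b j)) :
    ∃ V : E →L[ℂ] F, Isometry V ∧ ∀ i, V (a i) = b i := by
  have hdense : DenseRange (Finsupp.linearCombination ℂ a) := by
    rw [DenseRange, ← LinearMap.coe_range, Finsupp.range_linearCombination]
    exact ha
  have hnorm (f : ι →₀ ℂ) :
      ‖Finsupp.linearCombination ℂ b f‖ = ‖Finsupp.linearCombination ℂ a f‖ := by
    rw [@norm_eq_sqrt_re_inner ℂ, @norm_eq_sqrt_re_inner ℂ, inner_linearCombination_eq h]
  have hV (f : ι →₀ ℂ) : (Finsupp.linearCombination ℂ b).extendOfNorm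
      (Finsupp.linearCombination ℂ a) (Finsupp.linearCombination ℂ a f) =
        Finsupp.linearCombination ℂ b f :=
    LinearMap.extendOfNorm_eq hdense ⟨1, fun f => by rw [one_mul, hnorm]⟩ f
  refine ⟨(Finsupp.linearCombination ℂ b).extendOfNorm (Finsupp.linearCombination ℂ a), ?_, ?_⟩
  · refine AddMonoidHomClass.isometry_of_norm _ fun x => ?_
    refine hdense.induction_on (p := fun x => ‖(Finsupp.linearCombination ℂ b).extendOfNorm
      (Finsupp.linearCombination ℂ a) x‖ = ‖x‖) x ?_ fun f => ?_
    · exact isClosed_eq (by fun_prop) (by fun_prop)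
    · rw [hV, hnorm]
  · intro i
    simpa using hV (Finsupp.single i 1)

/-- The Kolmogorov decomposition of a positive semidefinite operator-valued kernel. -/
theorem exists_kolmogorov_decomposition.{u, v} {X : Type u} {H : Type v} [NormedAddCommGroup H]
    [InnerProductSpace ℂ H] [CompleteSpace H] {K : Matrix X X (H →L[ℂ] H)} (hK : K.PosSemidef) :
    ∃ (E : Type (max u v)) (_ : NormedAddCommGroup E) (_ : InnerProductSpace ℂ E)
      (_ : CompleteSpace E) (k : X → H →L[ℂ] E), (∀ x y, (k x).adjoint ∘L k y = K x y) ∧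
      (Submodule.span ℂ {z : E | ∃ (x : X) (v : H), k x v = z}).topologicalClosure = ⊤ := by
  have : Fact K.PosSemidef := ⟨hK⟩
  exact ⟨RKHS.OfKernel K, inferInstance, inferInstance, inferInstance,
    RKHS.kerFun (RKHS.OfKernel K),
    fun x y => congrFun (congrFun (RKHS.OfKernel.kernel_ofKernel (K := K)) x) y,
    RKHS.kerFun_dense (RKHS.OfKernel K)⟩

end Extension

namespace GradedLcmMonoid

section Dilation

variable {P : Type*} [Monoid P] [GradedLcmMonoid P]
variable {H : Type*} [NormedAddCommGroup H] [InnerProductSpace ℂ H] [CompleteSpace H]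
variable (T : P →* (H →L[ℂ] H))

theorem regularKernel_mul_left (r p q : P) :
    regularKernel T (r * p) (r * q) = regularKernel T p q := by
  have h (p q : P) : residual (r * p) (r * q) = residual p q := by
    refine residual_eq ?_
    rw [mul_assoc, mul_residual, mul_join]
  rw [regularKernel, regularKernel, h, h]

theorem star_regularKernel (p q : P) : star (regularKernel T p q) = regularKernel T q p := by
  rw [regularKernel, star_mul, star_star, regularKernel]

theorem regularKernel_self (p : P) : regularKernel T p p = 1 := by
  rw [regularKernel, residual_eq_one dvd_rfl, map_one, star_one, mul_one]

theorem regularKernel_one_left (p : P) : regularKernel T 1 p = T p := by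
  rw [regularKernel, one_residual, residual_eq_one (one_dvd p), map_one, star_one, mul_one]

/-- This is the formula for V(b)^* on the Kolmogorov vectors, written at the level of the kernel. -/
theorem regularKernel_mul_eq (b x y : P) :
    regularKernel T (b * y) x =
      regularKernel T y (residual b x) * star (T (residual x b)) := by
  rw [regularKernel, regularKernel, mul_residual_left, residual_mul_right, map_mul, star_mul,
    mul_assoc]

theorem posSemidef_regularKernel (h : IsCompletelyPositiveDefinite (regularKernel T)) :
    Matrix.PosSemidef (regularKernel T : Matrix P P (H →L[ℂ] H)) := by
  have htfae := (RKHS.posSemidef_tfae (K := (regularKernel T : Matrix P P (H →L[ℂ] H)))).out 0 2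
  refine htfae.mpr ⟨?_, fun v => ?_⟩
  · ext1 p q
    exact star_regularKernel T q p
  · have h0 := h _ (fun i => (v.support.equivFin.symm i : P))
      fun i => v (v.support.equivFin.symm i : P)
    rw [v.support.equivFin.symm.sum_comp (fun i => ∑ j, inner ℂ (v (i : P))
      (regularKernel T i (v.support.equivFin.symm j : P) (v (v.support.equivFin.symm j : P))))] at h0
    have h1 (i : P) := v.support.equivFin.symm.sum_comp (fun j : v.support =>
      inner ℂ (v i) (regularKernel T i j (v (j : P))))
    simp only [h1] at h0
    rw [Finset.sum_coe_sort v.support (fun i => ∑ j : v.support, inner ℂ (v i)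
      (regularKernel T i j (v (j : P))))] at h0
    have h2 (i : P) := Finset.sum_coe_sort v.support fun j =>
      inner ℂ (v i) (regularKernel T i j (v j))
    simp only [h2] at h0
    have h3 := (Complex.nonneg_iff.mp h0).1
    refine h3.trans_eq ?_
    rw [Finset.sum_comm, Finsupp.sum]
    simp only [Finsupp.sum]
    rw [Complex.re_sum, map_sum]
    refine Finset.sum_congr rfl fun i _ => ?_
    rw [Complex.re_sum, map_sum]
    refine Finset.sum_congr rfl fun j _ => ?_
    exact inner_re_symm (𝕜 := ℂ) _ _

end Dilation

/-- Left translation preserves the kernel, so k_p v ↦ k_{qp} v extends to an isometry V(q). H embeds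
by k_1, since K(1, 1) = 1. -/
theorem hasMinimalIsometricNicaDilation_of_isCompletelyPositiveDefinite.{u, v}
    {P : Type u} [Monoid P] [GradedLcmMonoid P] {H : Type v} [NormedAddCommGroup H]
    [InnerProductSpace ℂ H] [CompleteSpace H] (T : P →* (H →L[ℂ] H))
    (h : IsCompletelyPositiveDefinite (regularKernel T)) :
    HasMinimalIsometricNicaDilation T := by
  obtain ⟨E, _, _, _, k, hk, htop⟩ := exists_kolmogorov_decomposition (posSemidef_regularKernel T h)
  have hinner : ∀ p q x y, inner ℂ (k p x) (k q y) = inner ℂ x (regularKernel T p q y) := by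
    intro p q x y
    rw [← hk, ContinuousLinearMap.comp_apply, ContinuousLinearMap.adjoint_inner_right]
  have hrange : Set.range (fun x : P × H => k x.1 x.2) = {x : E | ∃ (p : P) (v : H), k p v = x} := by
    ext x; simp
  have hd : Dense (Submodule.span ℂ {x : E | ∃ (p : P) (v : H), k p v = x} : Set E) :=
    (Submodule.dense_iff_topologicalClosure_eq_top).mpr htop
  have hV : ∀ q, ∃ V : E →L[ℂ] E, Isometry V ∧ ∀ x : P × H, V (k x.1 x.2) = k (q * x.1) x.2 := by
    intro q
    refine exists_isometry_extending (by rw [hrange]; exact hd) fun x y => ?_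
    rw [hinner, hinner, regularKernel_mul_left]
  choose V hVi hVk using hV
  have hext : ∀ A B : E →L[ℂ] E, (∀ p v, A (k p v) = B (k p v)) → A = B := by
    intro A B hAB
    refine ContinuousLinearMap.ext_on hd ?_
    rintro _ ⟨p, v, rfl⟩
    exact hAB p v
  have hext' : ∀ x y : E, (∀ p v, inner ℂ (k p v) x = inner ℂ (k p v) y) → x = y := by
    intro x y hxy
    refine eq_of_inner_span_eq hd ?_
    rintro _ ⟨p, v, rfl⟩
    exact hxy p v
  let V' : P →* (E →L[ℂ] E) :=
    { toFun := V
      map_one' := hext _ _ fun p v => by simpa using hVk 1 (p, v)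
      map_mul' := fun a b => hext _ _ fun p v => by
        rw [hVk (a * b) (p, v), mul_apply_eq_comp, hVk b (p, v), hVk a (b * p, v), mul_assoc] }
  have hstar : ∀ b x v, (V b).adjoint (k x v) = k (residual b x) (star (T (residual x b)) v) := by
    intro b x v
    refine hext' _ _ fun y w => ?_
    rw [ContinuousLinearMap.adjoint_inner_right, hVk b (y, w), hinner, hinner, regularKernel_mul_eq]
    rfl
  -- The range projection of V(b) moves the index x to x ∨ b, so Nica covariance becomes
  -- associativity of joins.
  have hproj : ∀ b x v, (V b * (V b).adjoint) (k x v) =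
      k (join x b) (star (T (residual x b)) v) := by
    intro b x v
    rw [mul_apply_eq_comp, hstar, hVk b (_, _), mul_residual, join_comm]
  let J : H →ₗᵢ[ℂ] E := ⟨(k 1).toLinearMap, fun x => by
    rw [@norm_eq_sqrt_re_inner ℂ, @norm_eq_sqrt_re_inner ℂ]
    change Real.sqrt (RCLike.re (inner ℂ (k 1 x) (k 1 x))) = _
    rw [hinner, regularKernel_self]
    rfl⟩
  have hJ : ∀ p x, V p (J x) = k p x := fun p x => by
    have := hVk p (1, x)
    rwa [mul_one] at this
  refine ⟨E, inferInstance, inferInstance, inferInstance, J, V', ⟨fun p => ?_, ?_⟩, hVi, ?_, ?_⟩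
  · ext x
    refine ext_inner_left ℂ fun y => ?_
    change _ = inner ℂ y ((k 1).adjoint (V p (J x)))
    rw [hJ, ContinuousLinearMap.adjoint_inner_right, hinner, regularKernel_one_left]
  · have hset : {x : E | ∃ (p : P) (v : H), V' p (J v) = x} =
        {x : E | ∃ (p : P) (v : H), k p v = x} := by
      ext x
      change (∃ (p : P) (v : H), V p (J v) = x) ↔ _
      simp only [hJ, Set.mem_ofPred_eq]
    rw [hset, htop]
  · intro p q r hr
    rw [mem_joinSet_pair] at hr
    refine hext _ _ fun x v => ?_
    change (V p * (V p).adjoint) ((V q * (V q).adjoint) (k x v)) = (V r * (V r).adjoint) (k x v)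
    rw [hproj, hproj, hproj, hr, join_comm p q, ← residual_mul_residual, map_mul, star_mul,
      join_assoc]
    rfl
  · intro p q hpq
    exact absurd (mem_joinSet_pair.mpr rfl) (hpq ▸ Set.notMem_empty (join p q))

/-! ### From a dilation back to positivity -/

section Converse

variable {P : Type*} [Monoid P]
variable {H : Type*} [NormedAddCommGroup H] [InnerProductSpace ℂ H] [CompleteSpace H]
variable {K : Type*} [NormedAddCommGroup K] [InnerProductSpace ℂ K] [CompleteSpace K]
variable {T : P →* (H →L[ℂ] H)} {J : H →ₗᵢ[ℂ] K} {V : P →* (K →L[ℂ] K)}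

/-- `H` is co-invariant for a minimal dilation. -/
theorem star_apply_of_isMinimalDilation (h : IsMinimalDilation T J V) (p : P) (x : H) :
    star (V p) (J x) = J (star (T p) x) := by
  have hJ (p : P) (y z : H) : inner ℂ (V p (J y)) (J z) = inner ℂ (T p y) z := by
    rw [h.1 p]
    exact (ContinuousLinearMap.adjoint_inner_left J.toContinuousLinearMap z (V p (J y))).symm
  refine eq_of_inner_span_eq ((Submodule.dense_iff_topologicalClosure_eq_top).mpr h.2) ?_
  rintro _ ⟨q, y, rfl⟩
  have h1 : inner ℂ (V q (J y)) (star (V p) (J x)) = inner ℂ (V p (V q (J y))) (J x) :=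
    ContinuousLinearMap.adjoint_inner_right _ _ _
  have h2 : inner ℂ (T q y) (star (T p) x) = inner ℂ (T p (T q y)) x :=
    ContinuousLinearMap.adjoint_inner_right _ _ _
  rw [h1, hJ, h2, ← mul_apply_eq_comp, ← map_mul, hJ, map_mul, mul_apply_eq_comp]

theorem star_mul_self_of_isIsometricNicaCovariant (hV : IsIsometricNicaCovariant V) (p : P) :
    star (V p) * V p = 1 :=
  (V p).norm_map_iff_adjoint_comp_self.mp
    (fun x => (AddMonoidHomClass.isometry_iff_norm (V p)).mp (hV.1 p) x)

variable [GradedLcmMonoid P]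

/-- Multiply the covariance identity by V(p)^* on the left and V(q) on the right, and factor V(p ∨
q) through p and through q. -/
theorem star_mul_of_isIsometricNicaCovariant (hV : IsIsometricNicaCovariant V) (p q : P) :
    star (V p) * V q = V (residual p q) * star (V (residual q p)) := by
  have h := hV.2.1 p q _ (mem_joinSet_pair.mpr rfl)
  simp only [← ContinuousLinearMap.star_eq_adjoint] at h
  have hp := star_mul_self_of_isIsometricNicaCovariant hV p
  have hq := star_mul_self_of_isIsometricNicaCovariant hV q
  have h1 : star (V p) * (V p * star (V p) * (V q * star (V q))) * V q = star (V p) * V q := by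
    simp only [← mul_assoc, hp, one_mul]
    rw [mul_assoc, mul_assoc, hq, mul_one]
  rw [← h1, h]
  nth_rw 1 [← mul_residual p q]
  rw [join_comm, ← mul_residual q p, map_mul, map_mul, star_mul]
  simp only [← mul_assoc, hp, one_mul]
  rw [mul_assoc, hq, mul_one]

/-- The Brehmer operators of an isometric Nica-covariant representation are projections. -/
theorem isStarProjection_brehmerList (hV : IsIsometricNicaCovariant V) (L : List P) :
    IsStarProjection (brehmerList V L 1) ∧
      (∀ x, Commute (V x * star (V x)) (brehmerList V L 1)) ∧
      ∀ r, V r * brehmerList V L r * star (V r) = V r * star (V r) * brehmerList V L 1 := by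
  have hmul (p q : P) : V p * star (V p) * (V q * star (V q)) =
      V (join p q) * star (V (join p q)) := hV.2.1 p q _ (mem_joinSet_pair.mpr rfl)
  have hproj (p : P) : IsStarProjection (V p * star (V p)) :=
    ⟨by rw [IsIdempotentElem, hmul, join_eq_left dvd_rfl], .mul_star_self _⟩
  have hcomm (p q : P) : Commute (V p * star (V p)) (V q * star (V q)) := by
    rw [Commute, SemiconjBy, hmul, hmul, join_comm]
  induction L with
  | nil => exact ⟨.one _, fun x => Commute.one_right _, fun r => by simp [brehmerList]⟩
  | cons x L ih =>
    obtain ⟨h1, h2, h3⟩ := ih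
    -- The alternating sum becomes a product of commuting projections.
    have e : brehmerList V (x :: L) 1 = (1 - V x * star (V x)) * brehmerList V L 1 := by
      rw [brehmerList_cons, one_residual, join_eq_right (one_dvd x), h3, sub_mul, one_mul]
    rw [e]
    refine ⟨(hproj x).one_sub.mul h1 ((Commute.one_left _).sub_left (h2 x)), fun y =>
      ((Commute.one_right _).sub_right (hcomm y x)).mul_right (h2 y), fun r => ?_⟩
    have e' : V r * (V (residual r x) * brehmerList V L (join r x) * star (V (residual r x))) *
        star (V r) = V (join r x) * brehmerList V L (join r x) * star (V (join r x)) := by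
      rw [← mul_residual r x, map_mul, star_mul]
      simp only [mul_assoc]
    rw [brehmerList_cons, mul_sub, sub_mul, e', h3, h3, ← hmul, sub_mul, one_mul, mul_sub,
      ← mul_assoc (V r * star (V r)) (V x * star (V x))]

/-- Co-invariance of H turns the kernel into the Gram matrix of the vectors V(p_i)h_i. -/
theorem isCompletelyPositiveDefinite_of_isMinimalDilation (hV : IsIsometricNicaCovariant V)
    (h : IsMinimalDilation T J V) :
    IsCompletelyPositiveDefinite (regularKernel T) := by
  intro n p v
  have key (i j : Fin n) : inner ℂ (v i) (regularKernel T (p i) (p j) (v j)) =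
      inner ℂ (V (p i) (J (v i))) (V (p j) (J (v j))) := by
    have h1 : inner ℂ (V (p i) (J (v i))) (V (p j) (J (v j))) =
        inner ℂ (J (v i)) ((star (V (p i)) * V (p j)) (J (v j))) :=
      (ContinuousLinearMap.adjoint_inner_right (V (p i)) _ _).symm
    rw [h1, star_mul_of_isIsometricNicaCovariant hV, mul_apply_eq_comp,
      star_apply_of_isMinimalDilation h, regularKernel, mul_apply_eq_comp, h.1 (residual (p i) (p j))]
    exact ContinuousLinearMap.adjoint_inner_right J.toContinuousLinearMap _ _
  simp only [key]
  simp only [← inner_sum, ← sum_inner]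
  have hz (z : K) : (0 : ℂ) ≤ inner ℂ z z := by
    rw [inner_self_eq_norm_sq_to_K (𝕜 := ℂ)]
    exact pow_nonneg (Complex.zero_le_real.mpr (norm_nonneg z)) 2
  exact hz _

/-- Co-invariance gives J^*V(p) = T(p)J^*, so the recursion for V compresses to the one for T. -/
theorem brehmerList_nonneg_of_isMinimalDilation (hV : IsIsometricNicaCovariant V)
    (h : IsMinimalDilation T J V) (L : List P) : 0 ≤ brehmerList T L 1 := by
  have key : ∀ r x, brehmerList T L r x =
      J.toContinuousLinearMap.adjoint (brehmerList V L r (J x)) := by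
    have hJJ : ∀ x, J.toContinuousLinearMap.adjoint (J x) = x := fun x =>
      ext_inner_left ℂ fun y => by
        rw [ContinuousLinearMap.adjoint_inner_right]
        exact J.inner_map_map y x
    induction L with
    | nil => exact fun r x => (hJJ x).symm
    | cons y L ih =>
      intro r x
      have hT (p : P) (z : K) : J.toContinuousLinearMap.adjoint (V p z) =
          T p (J.toContinuousLinearMap.adjoint z) := by
        refine ext_inner_left ℂ fun w => ?_
        rw [ContinuousLinearMap.adjoint_inner_right, ← ContinuousLinearMap.adjoint_inner_left (V p),
          ← ContinuousLinearMap.adjoint_inner_left (T p), ContinuousLinearMap.adjoint_inner_right]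
        exact congrArg (inner ℂ · z) (star_apply_of_isMinimalDilation h p w)
      simp only [brehmerList_cons, sub_apply, map_sub, mul_apply_eq_comp, ih, hT,
        star_apply_of_isMinimalDilation h]
  refine (ContinuousLinearMap.nonneg_iff_isPositive _).mpr ?_
  have hpos := (ContinuousLinearMap.nonneg_iff_isPositive _).mp
    (isStarProjection_brehmerList hV L).1.nonneg
  have e : brehmerList T L 1 = J.toContinuousLinearMap.adjoint ∘L brehmerList V L 1 ∘L
      J.toContinuousLinearMap := by
    ext x
    exact key 1 x
  rw [e]
  exact hpos.adjoint_conj _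

end Converse

end GradedLcmMonoid

end

/-! ### Assembling the equivalences -/

noncomputable section

namespace GradedLcmMonoid

variable {P : Type*} [Monoid P] [GradedLcmMonoid P]
variable {H : Type*} [NormedAddCommGroup H] [InnerProductSpace ℂ H] [CompleteSpace H]
variable (T : P →* (H →L[ℂ] H))

theorem isStarRegular_iff_hasMinimalIsometricNicaDilation :
    IsStarRegular T ↔ HasMinimalIsometricNicaDilation T := by
  rw [isStarRegular_iff]
  refine ⟨hasMinimalIsometricNicaDilation_of_isCompletelyPositiveDefinite T, ?_⟩
  rintro ⟨_, _, _, _, _, _, hmin, hV⟩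
  exact isCompletelyPositiveDefinite_of_isMinimalDilation hV hmin

theorem isStarRegular_iff_brehmerList_nonneg :
    IsStarRegular T ↔ ∀ L : List P, 0 ≤ brehmerList T L 1 := by
  refine ⟨fun h L => ?_, fun h =>
    (isStarRegular_iff T).mpr (isCompletelyPositiveDefinite_regularKernel T h)⟩
  obtain ⟨_, _, _, _, _, _, hmin, hV⟩ := (isStarRegular_iff_hasMinimalIsometricNicaDilation T).mp h
  exact brehmerList_nonneg_of_isMinimalDilation hV hmin L

theorem brehmerList_singleton (x : P) : brehmerList T [x] 1 = 1 - T x * star (T x) := by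
  rw [brehmerList_cons, one_residual, brehmerList, brehmerList, mul_one]

theorem brehmerList_pair (x y : P) : brehmerList T [x, y] 1 =
    1 - T x * star (T x) - T y * star (T y) + T (join x y) * star (T (join x y)) := by
  rw [brehmerList_cons, one_residual, brehmerList_singleton, join_eq_right (one_dvd x),
    brehmerList_cons, brehmerList, brehmerList, mul_one, mul_sub, sub_mul, mul_one,
    ← mul_residual x y, map_mul, star_mul]
  simp only [mul_assoc]
  abel

end GradedLcmMonoid

theorem one_sub_mul_star_nonneg {H : Type*} [NormedAddCommGroup H] [InnerProductSpace ℂ H]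
    [CompleteSpace H] {A : H →L[ℂ] H} (h : ‖A‖ ≤ 1) : 0 ≤ 1 - A * star A := by
  rw [sub_nonneg, ← CStarAlgebra.norm_le_one_iff_of_nonneg (A * star A) (mul_star_self_nonneg A),
    CStarRing.norm_self_mul_star]
  exact mul_le_one₀ h (norm_nonneg A) h

namespace ArtinMonoid

open GradedLcmMonoid

variable {B : Type*} {M : CoxeterMatrix B}
variable {H : Type*} [NormedAddCommGroup H] [InnerProductSpace ℂ H] [CompleteSpace H]

theorem isContractiveRep_of_gen (T : ArtinMonoid M →* (H →L[ℂ] H))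
    (h : ∀ i, ‖T (artinGen M i)‖ ≤ 1) : IsContractiveRep T := by
  intro p
  induction p using induction_left with
  | one => rw [map_one]; exact ContinuousLinearMap.norm_id_le
  | mul i x ih =>
    rw [map_mul]
    exact (norm_mul_le _ _).trans (mul_le_one₀ (h i) (norm_nonneg _) ih)

variable [Finite M.Group] (T : ArtinMonoid M →* (H →L[ℂ] H))

theorem isStarRegular_of_brehmerList_gen
    (h : ∀ L : List (ArtinMonoid M), L.Nodup → (∀ x ∈ L, x ∈ Set.range (artinGen M)) →
      0 ≤ brehmerList T L 1) : IsStarRegular T := by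
  rw [isStarRegular_iff_brehmerList_nonneg]
  refine brehmerList_nonneg_of_generators T (Set.range (artinGen M)) ?_ ?_ h
  · rintro _ ⟨i, rfl⟩
    exact one_ne_zero
  · intro x
    refine (exists_gen_mul x).imp_right ?_
    rintro ⟨i, y, rfl⟩
    exact ⟨_, ⟨i, rfl⟩, y, rfl⟩

theorem isStarRegular_iff_brehmerZ_nonneg :
    IsStarRegular T ↔ ∀ F : Finset (ArtinMonoid M),
      (F : Set (ArtinMonoid M)) ⊆ Set.range (artinGen M) → 0 ≤ brehmerZ T F := by
  classical
  refine ⟨fun h F _ => ?_, fun h => isStarRegular_of_brehmerList_gen T fun L hL hLG => ?_⟩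
  · rw [brehmerZ_eq]
    exact (isStarRegular_iff_brehmerList_nonneg T).mp h _
  · have := h L.toFinset fun x hx => hLG x (by simpa using hx)
    rwa [brehmerZ_eq, brehmerList_perm T (List.toFinset_toList hL)] at this

end ArtinMonoid

/-! ### The braid monoid on three strands -/

theorem isFiniteType_A_two : IsFiniteType (CoxeterMatrix.A 2) := by
  set M := CoxeterMatrix.A 2
  set cs := M.toCoxeterSystem
  obtain ⟨a, ha⟩ : ∃ a, a = cs.simple 0 := ⟨_, rfl⟩
  obtain ⟨b, hb⟩ : ∃ b, b = cs.simple 1 := ⟨_, rfl⟩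
  have haa : a * a = 1 := by rw [ha, cs.simple_mul_simple_self]
  have hbb : b * b = 1 := by rw [hb, cs.simple_mul_simple_self]
  have hM : M 0 1 = 3 := by decide
  have hab : a * b * a = b * a * b := by
    have h := cs.wordProd_altWord_comm 0 1
    rw [hM] at h
    simpa [altWord, CoxeterSystem.wordProd, ← ha, ← hb, mul_assoc] using h
  -- These six words are closed under left multiplication by a and b.
  have hfin : (Set.univ : Set M.Group) ⊆ {1, a, b, a * b, b * a, a * b * a} := by
    intro w _
    have haa' (x : M.Group) : a * (a * x) = x := by rw [← mul_assoc, haa, one_mul]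
    have hbb' (x : M.Group) : b * (b * x) = x := by rw [← mul_assoc, hbb, one_mul]
    have hab' : b * (a * b) = a * (b * a) := by rw [← mul_assoc, ← mul_assoc, hab]
    induction w using cs.simple_induction_left with
    | one => simp
    | mul_simple_left w i ih =>
      have hi : cs.simple i = a ∨ cs.simple i = b := by
        fin_cases i
        · exact Or.inl ha.symm
        · exact Or.inr hb.symm
      have h1 : b * (a * (b * a)) = a * b := by
        rw [← hab', hbb']
      simp only [Set.mem_insert_iff, Set.mem_singleton_iff] at ih ⊢
      rcases hi with hi | hi <;> rw [hi] <;>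
        rcases ih trivial with rfl | rfl | rfl | rfl | rfl | rfl <;>
        simp [mul_assoc, haa, hbb, haa', hbb', hab', h1]
  exact Set.finite_univ_iff.mp ((Set.toFinite _).subset hfin)

instance : Finite (CoxeterMatrix.A 2).Group := isFiniteType_A_two

namespace ArtinMonoid

open GradedLcmMonoid

local notation "e₀" => artinGen (CoxeterMatrix.A 2) 0
local notation "e₁" => artinGen (CoxeterMatrix.A 2) 1

theorem braid_A_two : e₀ * e₁ * e₀ = e₁ * e₀ * e₁ := by
  have hM : CoxeterMatrix.A 2 0 1 = 3 := by decide
  have h := braid (M := CoxeterMatrix.A 2) 0 1 (by decide) (by rw [hM]; decide)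
  rw [hM] at h
  simpa [altWord, mul_assoc] using h

/-- The representation of the braid monoid by integral matrices. -/
def matrixRep : ArtinMonoid (CoxeterMatrix.A 2) →* Matrix (Fin 2) (Fin 2) ℤ :=
  lift (![!![1, 1; 0, 1], !![1, 0; -1, 1]] : Fin 2 → Matrix (Fin 2) (Fin 2) ℤ) <| by
    have h01 : CoxeterMatrix.A 2 0 1 = 3 := by decide
    have h10 : CoxeterMatrix.A 2 1 0 = 3 := by decide
    intro i j hij _
    fin_cases i <;> fin_cases j
    · exact absurd rfl hij
    · change (List.map _ (altWord 0 1 (CoxeterMatrix.A 2 0 1))).prod =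
        (List.map _ (altWord 1 0 (CoxeterMatrix.A 2 0 1))).prod
      rw [h01]
      decide
    · change (List.map _ (altWord 1 0 (CoxeterMatrix.A 2 1 0))).prod =
        (List.map _ (altWord 0 1 (CoxeterMatrix.A 2 1 0))).prod
      rw [h10]
      decide
    · exact absurd rfl hij

/-- The join divides e₀e₁e₀. If it were shorter, then e₀x = e₁y with x and y of length at most 1,
and the integral matrices rule out all nine cases. -/
theorem join_A_two : join e₀ e₁ = e₀ * e₁ * e₀ := by
  have h1 : join e₀ e₁ ∣ e₀ * e₁ * e₀ := by
    refine join_dvd (by rw [mul_assoc]; exact dvd_mul_right _ _) ?_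
    rw [braid_A_two, mul_assoc]
    exact dvd_mul_right _ _
  refine dvd_antisymm h1 ?_
  by_contra hne
  have hlt : ArtinMonoid.len (join e₀ e₁) < ArtinMonoid.len (e₀ * e₁ * e₀) := len_lt_of_dvd h1 hne
  obtain ⟨x, hx⟩ := dvd_join_left e₀ e₁
  obtain ⟨y, hy⟩ := dvd_join_right e₀ e₁
  have hlx : ArtinMonoid.len x ≤ 1 := by
    rw [hx] at hlt
    simp only [ArtinMonoid.len_mul, len_gen] at hlt
    omega
  have hly : ArtinMonoid.len y ≤ 1 := by
    rw [hy] at hlt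
    simp only [ArtinMonoid.len_mul, len_gen] at hlt
    omega
  have small : ∀ z : ArtinMonoid (CoxeterMatrix.A 2), ArtinMonoid.len z ≤ 1 →
      z = 1 ∨ z = e₀ ∨ z = e₁ := by
    intro z hz
    rcases exists_gen_mul z with rfl | ⟨i, w, rfl⟩
    · exact Or.inl rfl
    · rw [ArtinMonoid.len_mul, len_gen] at hz
      rw [ArtinMonoid.eq_one_of_len_eq_zero w (by omega), mul_one]
      fin_cases i <;> simp
  have hxy := congrArg matrixRep (hx.symm.trans hy)
  rw [map_mul, map_mul] at hxy
  have m0 : matrixRep e₀ = !![1, 1; 0, 1] := rfl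
  have m1 : matrixRep e₁ = !![1, 0; -1, 1] := rfl
  revert hxy
  rcases small x hlx with rfl | rfl | rfl <;> rcases small y hly with rfl | rfl | rfl <;>
    simp only [map_one, m0, m1] <;> decide

end ArtinMonoid

theorem mainTheorem5 {H : Type*} [NormedAddCommGroup H] [InnerProductSpace ℂ H]
    [CompleteSpace H] :
    (∀ (n : ℕ) (M : CoxeterMatrix (Fin n)), IsFiniteType M →
      ∀ T : ArtinMonoid M →* (H →L[ℂ] H), IsContractiveRep T →
        (IsStarRegular T ↔
          ∀ F : Finset (ArtinMonoid M), (F : Set (ArtinMonoid M)) ⊆ Set.range (artinGen M) →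
            0 ≤ brehmerZ T F) ∧
        (HasMinimalIsometricNicaDilation T ↔
          ∀ F : Finset (ArtinMonoid M), (F : Set (ArtinMonoid M)) ⊆ Set.range (artinGen M) →
            0 ≤ brehmerZ T F)) ∧
    (∀ (T : ArtinMonoid (CoxeterMatrix.A 2) →* (H →L[ℂ] H)) (T₁ T₂ : H →L[ℂ] H),
      T₁ = T (artinGen (CoxeterMatrix.A 2) 0) → T₂ = T (artinGen (CoxeterMatrix.A 2) 1) →
        ((IsContractiveRep T ∧ IsStarRegular T) ↔
          ‖T₁‖ ≤ 1 ∧ ‖T₂‖ ≤ 1 ∧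
            0 ≤ 1 - T₁ * ContinuousLinearMap.adjoint T₁ - T₂ * ContinuousLinearMap.adjoint T₂ +
              T₁ * T₂ * T₁ * ContinuousLinearMap.adjoint T₁ * ContinuousLinearMap.adjoint T₂ *
                ContinuousLinearMap.adjoint T₁)) := by
  refine ⟨fun n M hM T _ => ?_, ?_⟩
  · have : Finite M.Group := hM
    have h := ArtinMonoid.isStarRegular_iff_brehmerZ_nonneg T
    exact ⟨h, (GradedLcmMonoid.isStarRegular_iff_hasMinimalIsometricNicaDilation T).symm.trans h⟩
  · rintro T _ _ rfl rfl
    have hpair := GradedLcmMonoid.brehmerList_pair T (artinGen (CoxeterMatrix.A 2) 0)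
      (artinGen (CoxeterMatrix.A 2) 1)
    rw [ArtinMonoid.join_A_two, map_mul, map_mul, star_mul, star_mul] at hpair
    simp only [← ContinuousLinearMap.star_eq_adjoint]
    simp only [mul_assoc] at hpair ⊢
    rw [← hpair]
    refine ⟨fun ⟨hc, hr⟩ => ⟨hc _, hc _,
      (GradedLcmMonoid.isStarRegular_iff_brehmerList_nonneg T).mp hr _⟩, fun ⟨h₁, h₂, h₁₂⟩ => ?_⟩
    have hgen : ∀ i, ‖T (artinGen (CoxeterMatrix.A 2) i)‖ ≤ 1 := by
      intro i
      fin_cases i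
      · exact h₁
      · exact h₂
    refine ⟨ArtinMonoid.isContractiveRep_of_gen T hgen,
      ArtinMonoid.isStarRegular_of_brehmerList_gen T fun L hL hLG => ?_⟩
    -- A duplicate-free list from two generators has at most two entries: the singletons are the
    -- norm bounds and the pair is the displayed inequality.
    rcases L with _ | ⟨x, _ | ⟨y, _ | ⟨z, L⟩⟩⟩
    · exact zero_le_one
    · obtain ⟨i, rfl⟩ := hLG x (by simp)
      rw [GradedLcmMonoid.brehmerList_singleton]
      exact one_sub_mul_star_nonneg (hgen i)
    · obtain ⟨i, rfl⟩ := hLG x (by simp)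
      obtain ⟨j, rfl⟩ := hLG y (by simp)
      fin_cases i <;> fin_cases j
      · simp at hL
      · exact h₁₂
      · rw [GradedLcmMonoid.brehmerList_perm T (List.Perm.swap _ _ _)]
        exact h₁₂
      · simp at hL
    · obtain ⟨i, rfl⟩ := hLG x (by simp)
      obtain ⟨j, rfl⟩ := hLG y (by simp)
      obtain ⟨k, rfl⟩ := hLG z (by simp)
      fin_cases i <;> fin_cases j <;> fin_cases k <;> simp at hL

end
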